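/- **Setting.** Consider the plant $\dot x = Ax + Bu + B_v v$ with $x(t)\in\mathbb R^n$, $u(t)\in\mathbb R^m$ and an unknown input $v(t)\in\mathbb R^{m_v}$ with $\|v(t)\|\le\bar v$ for all $t\ge 0$. There are controller nodes $\iota=1,\dots,N_c$ with inputs $u^\iota$ and channels $B^\iota$, where the terms $Bu$ are exactly the terms $\sum_\iota B^\iota u^\iota$ (that is, $\operatorname{Im}B=\sum_\iota\operatorname{Im}B^\iota$), and observer nodes $i=1,\dots,N$. Observer node $i$ measures $y_i=C_i x$ ($C_i$ of full row rank) and receives a part $u_i=\sum_\iota S_{i\iota}u^\iota$ of the control inputs ($S_{i\iota}$ given matrices), and $Bu+B_vv=B_iu_i+B_{-i}u_{-i}$ with $B_{-i}$ of full column rank and $u_{-i}$ unavailable to node $i$. The observer nodes communicate over a graph with nonnegative weights $a_{ij}=a_{ji}$, $a_{ii}=0$. For each $i$ let $T_{id}\in\mathbb R^{n\times\delta_i}$, $E_i\in\mathbb R^{\delta_i\times\delta_i}$, $F_i,G_i\in\mathbb R^{\delta_i\times p_i}$ satisfy $T_{id}^\top T_{id}=I$, $G_iC_iB_{-i}=T_{id}^\top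 B_{-i}$, $E_iT_{id}^\top+(G_iC_i-T_{id}^\top)A+(F_i-E_iG_i)C_i=0$, and either all eigenvalues of $E_i$ have negative real part, or $E_i=0$, $F_i=0$ and $G_iC_i=T_{id}^\top$. Let $T_{iu}\in\mathbb R^{n\times(n-\delta_i)}$ satisfy $T_{id}^\top T_{iu}=0$, $T_{iu}^\top T_{iu}=I$, $T_{iu}T_{iu}^\top=I-T_{id}T_{id}^\top$. Observer node $i$ is $$\dot z_i=\bar E_iz_i+\bar F_iy_i+\bar B_iu_i-\gamma_iT_{iu}\varepsilon_{iu}-\gamma_{is}T_{iu}h(\varepsilon_{iu}),\quad z_i(0)=0,\qquad \hat x_i=z_i+\bar G_iy_i,\qquad \varepsilon_{iu}=T_{iu}^\top\sum_{j}a_{ij}(\hat x_i-\hat x_j),$$ with $\bar G_i=T_{id}G_i$, $\bar E_i=T_{id}E_iT_{id}^\top+T_{iu}T_{iu}^\top A$, $\bar F_i=T_{id}F_i+T_{iu}T_{iu}^\top A\bar G_i$, $\bar B_i=(I-\bar G_iC_i)B_i$, and $h(\omega)=\omega/\|\omega\|$ for $\omega\neq0$, where at $\omega=0$ the value of $h$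 may be any vector of the closed unit ball (so that sliding motions, as well as the choice $h(0)=0$, are included; solutions are locally absolutely continuous and satisfy the equations for almost every time). Put $e_i=\hat x_i-x$. Controller node $\iota$ uses the estimate of an arbitrary observer node $i'=i'(\iota)$ and applies $$u^\iota=K^\iota\hat x_{i'}-\beta^\iota h^\iota_\epsilon\big((B^\iota)^\top P\hat x_{i'}\big),\qquad h^\iota_\epsilon(\omega)=\begin{cases}\omega/\|\omega\|,&\beta^\iota\|\omega\|>\epsilon,\\ \beta^\iota\epsilon^{-1}\omega,&\beta^\iota\|\omega\|\le\epsilon,\end{cases}$$ where $P$ is symmetric positive definite and $(A+\sum_\iota B^\iota K^\iota)^\top P+P(A+\sum_\iota B^\iota K^\iota)$ is negative definite. The gains obey $$\dot\beta^\iota=-\sigma^\iota\beta^\iota+\phi^\iota\|(B^\iota)^\top P\hat x_{i'}\|,\qquad \dot\gamma_i=-\sigma_i\gamma_i+\phi_i\|\varepsilon_{iu}\|^2,\qquad \dot\gamma_{is}=-\sigma_{is}\gamma_{is}+\phi_{is}\|\varepsilon_{iu}\|,$$ with all of $\epsilon$, $\sigma^\iota,\sigma_i,\sigma_{is}$, $\phi^\iota,\phi_i,\phi_{is}$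 and the initial values $\beta^\iota(0),\gamma_i(0),\gamma_{is}(0)$ positive. **Theorem.** Suppose that $(A,B)$ is stabilizable, that $B_v=BX_v$ for some matrix $X_v$, that the observer graph is connected, and that $\sum_{i=1}^N\operatorname{Im}T_{id}=\mathbb R^n$. Then there is a rate $\alpha>0$, independent of $\bar v$, $\epsilon$ and the step sizes, and for every $\bar v$ and every choice of $\epsilon,\phi^\iota,\phi_i,\phi_{is}>0$ there is a bounded set $\mathcal R=\mathcal R(\epsilon,\phi^\iota,\phi_i,\phi_{is})$ of pairs $(x,(e_i)_{i})$, containing the origin and independent of the initial values and of $v$, such that: 1. for every $r$ there is a constant $M$ such that along every solution on an interval $[0,T)$, $0<T\le\infty$, with $\|x(0)\|$ and all initial gains at most $r$, all adaptive gains $\beta^\iota,\gamma_i,\gamma_{is}$ remain bounded by $M$ in absolute value, and $(x,(e_i)_i)$ converges exponentially to $\mathcal R$: $\operatorname{dist}\big((x(t),(e_i(t))_i),\mathcal R\big)\le Me^{-\alpha t}$ for all $t\in[0,T)$; 2. $\mathcal R$ can be made arbitrarily small by decreasing $\epsilon$ and increasing the step sizes: for every $\eta>0$ there are $\epsilon_0>0$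 and $\Phi>0$ such that for all $\phi^\iota\ge\Phi$ there is $\Phi'>0$ (which may depend on the $\phi^\iota$) such that for all $\phi_i\ge\Phi'$, all $\phi_{is}\ge\Phi$ and all $0<\epsilon\le\epsilon_0$ the set $\mathcal R$ lies in the ball of radius $\eta$ about the origin. -/

import Mathlib

open scoped Matrix

noncomputable section

/-- `ℝᵏ` with the Euclidean norm. -/
abbrev Vec (k : ℕ) : Type := EuclideanSpace ℝ (Fin k)

/-- `M ⊡ x` is the matrix-vector product `M x` for Euclidean vectors. -/
notation:73 M:74 " ⊡ " x:73 => Matrix.toEuclideanLin M x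

/-- All (complex) eigenvalues of the real square matrix `M` have negative real part. -/
def IsHurwitz {k : ℕ} (M : Matrix (Fin k) (Fin k) ℝ) : Prop :=
  ∀ μ ∈ spectrum ℂ (M.map (algebraMap ℝ ℂ)), μ.re < 0

/-- The pair `(A, B)` is stabilizable. -/
def IsStabilizable {n m : ℕ} (A : Matrix (Fin n) (Fin n) ℝ) (B : Matrix (Fin n) (Fin m) ℝ) : Prop :=
  ∃ K : Matrix (Fin m) (Fin n) ℝ, IsHurwitz (A + B * K)

/-- The data of the problem: the plant `ẋ = A x + B u + B_v v`, the channels `B^ι` of the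
controller nodes, the local outputs `y_i = C_i x` and the input splitting
`B u + B_v v = B_i u_i + B_{-i} u_{-i}` at the observer nodes, the part
`u_i = ∑_ι S_{iι} u^ι` of the control inputs which is delivered to the observer node `i`
(e.g. a selection of some of the vectors `u^ι`), the observer node `est ι` whose state estimate is
delivered to the controller node `ι`, and the weights `a_{ij}` of the observer graph. -/
structure ControlNetwork where
  /-- dimension of the state -/
  n : ℕ
  /-- dimension of the control input -/
  m : ℕ
  /-- dimension of the unknown input -/
  mv : ℕ
  /-- number of observer nodes -/
  N : ℕ
  /-- number of controller nodes -/
  Nc : ℕ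
  A : Matrix (Fin n) (Fin n) ℝ
  B : Matrix (Fin n) (Fin m) ℝ
  Bv : Matrix (Fin n) (Fin mv) ℝ
  /-- dimension of `u^ι` -/
  mc : Fin Nc → ℕ
  /-- the matrices `B^ι` -/
  Bc : ∀ ι, Matrix (Fin n) (Fin (mc ι)) ℝ
  /-- dimension of the local output `y_i` -/
  p : Fin N → ℕ
  C : ∀ i, Matrix (Fin (p i)) (Fin n) ℝ
  /-- dimension of the available input `u_i` -/
  ml : Fin N → ℕ
  /-- the matrices `B_i` -/
  Bl : ∀ i, Matrix (Fin n) (Fin (ml i)) ℝ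
  /-- dimension of the unavailable input `u_{-i}` -/
  mu : Fin N → ℕ
  /-- the matrices `B_{-i}` -/
  Bu : ∀ i, Matrix (Fin n) (Fin (mu i)) ℝ
  /-- delivery of control inputs to the observer nodes -/
  S : ∀ i ι, Matrix (Fin (ml i)) (Fin (mc ι)) ℝ
  /-- the observer node whose estimate the controller node `ι` uses -/
  est : Fin Nc → Fin N
  /-- adjacency matrix of the observer graph -/
  a : Matrix (Fin N) (Fin N) ℝ

namespace ControlNetwork

/-- The part of the control inputs which is available to the observer node `i`. -/
def localInput (net : ControlNetwork) (u : ∀ ι, Vec (net.mc ι)) (i : Fin net.N) :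
    Vec (net.ml i) :=
  ∑ ι, net.S i ι ⊡ u ι

/-- The standing conventions: `C_i` has full row rank, `B_{-i}` has full column rank, the terms
`B u` are exactly the terms `∑_ι B^ι u^ι`, and the total input is `B_i u_i + B_{-i} u_{-i}`
for a suitable (unavailable) `u_{-i}`, whatever the control inputs and the unknown input are. -/
structure WellPosed (net : ControlNetwork) : Prop where
  rank_C : ∀ i, (net.C i).rank = net.p i
  rank_Bu : ∀ i, (net.Bu i).rank = net.mu i
  split_control : LinearMap.range net.B.mulVecLin = ⨆ ι, LinearMap.range (net.Bc ι).mulVecLin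
  split_local : ∀ (i : Fin net.N) (u : ∀ ι, Vec (net.mc ι)) (v : Vec net.mv),
    ∃ w : Vec (net.mu i),
      (∑ ι, net.Bc ι ⊡ u ι) + net.Bv ⊡ v = net.Bl i ⊡ net.localInput u i + net.Bu i ⊡ w

/-- The control and unknown inputs are matched. -/
def Matched (net : ControlNetwork) : Prop :=
  ∃ Xv : Matrix (Fin net.m) (Fin net.mv) ℝ, net.B * Xv = net.Bv

/-- The weights define an undirected connected graph without self-loops. -/
structure ConnectedGraph (net : ControlNetwork) : Prop where
  nonneg : ∀ i j, 0 ≤ net.a i j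
  no_loop : ∀ i, net.a i i = 0
  symm : ∀ i j, net.a i j = net.a j i
  connected : (SimpleGraph.fromRel fun i j => 0 < net.a i j).Connected

end ControlNetwork

/-- The matrices `T_id, E_i, F_i, G_i, T_iu` of the observer nodes. -/
structure ObserverDesign (net : ControlNetwork) where
  δ : Fin net.N → ℕ
  Td : ∀ i, Matrix (Fin net.n) (Fin (δ i)) ℝ
  E : ∀ i, Matrix (Fin (δ i)) (Fin (δ i)) ℝ
  F : ∀ i, Matrix (Fin (δ i)) (Fin (net.p i)) ℝ
  G : ∀ i, Matrix (Fin (δ i)) (Fin (net.p i)) ℝ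
  Tu : ∀ i, Matrix (Fin net.n) (Fin (net.n - δ i)) ℝ

namespace ObserverDesign

variable {net : ControlNetwork}

/-- Admissibility of the matrices: `(T_id, E_i, F_i, G_i)` is a functional unknown-input observer
for the triple `(A, B_{-i}, C_i)`, and `T_iu` completes `T_id` to an orthogonal matrix.
The quadruple need not have the largest possible `δ_i`. In the case of a zero matrix `E_i` the
observer is static: `F_i = 0` and `T_idᵀ x = G_i y_i`. -/
structure Admissible (D : ObserverDesign net) : Prop where
  orth : ∀ i, (D.Td i)ᵀ * D.Td i = 1
  decouple : ∀ i, D.G i * net.C i * net.Bu i = (D.Td i)ᵀ * net.Bu i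
  sylvester : ∀ i, D.E i * (D.Td i)ᵀ + (D.G i * net.C i - (D.Td i)ᵀ) * net.A
    + (D.F i - D.E i * D.G i) * net.C i = 0
  stable : ∀ i, IsHurwitz (D.E i) ∨
    (D.E i = 0 ∧ D.F i = 0 ∧ D.G i * net.C i = (D.Td i)ᵀ)
  Td_Tu : ∀ i, (D.Td i)ᵀ * D.Tu i = 0
  Tu_orth : ∀ i, (D.Tu i)ᵀ * D.Tu i = 1
  Tu_proj : ∀ i, D.Tu i * (D.Tu i)ᵀ = 1 - D.Td i * (D.Td i)ᵀ

/-- Collective strong detectability: `∑_i Im T_id = ℝⁿ`. -/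
def CollectivelyDetectable (D : ObserverDesign net) : Prop :=
  ⨆ i, LinearMap.range (D.Td i).mulVecLin = ⊤

/-- `Ḡ_i = T_id G_i` -/
def Gbar (D : ObserverDesign net) (i : Fin net.N) : Matrix (Fin net.n) (Fin (net.p i)) ℝ :=
  D.Td i * D.G i

/-- `Ē_i = T_id E_i T_idᵀ + T_iu T_iuᵀ A` -/
def Ebar (D : ObserverDesign net) (i : Fin net.N) : Matrix (Fin net.n) (Fin net.n) ℝ :=
  D.Td i * D.E i * (D.Td i)ᵀ + D.Tu i * (D.Tu i)ᵀ * net.A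

/-- `F̄_i = T_id F_i + T_iu T_iuᵀ A Ḡ_i` -/
def Fbar (D : ObserverDesign net) (i : Fin net.N) : Matrix (Fin net.n) (Fin (net.p i)) ℝ :=
  D.Td i * D.F i + D.Tu i * (D.Tu i)ᵀ * net.A * D.Gbar i

/-- `B̄_i = (I - Ḡ_i C_i) B_i` -/
def Bbar (D : ObserverDesign net) (i : Fin net.N) : Matrix (Fin net.n) (Fin (net.ml i)) ℝ :=
  (1 - D.Gbar i * net.C i) * net.Bl i

/-- The state estimate `x̂_i = z_i + Ḡ_i y_i` with `y_i = C_i x`. -/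
def estimate (D : ObserverDesign net) (x : Vec net.n) (z : Fin net.N → Vec net.n)
    (i : Fin net.N) : Vec net.n :=
  z i + D.Gbar i ⊡ net.C i ⊡ x

/-- `ε_iu = T_iuᵀ ∑_j a_ij (x̂_i - x̂_j)` -/
def disagreement (D : ObserverDesign net) (xhat : Fin net.N → Vec net.n) (i : Fin net.N) :
    Vec (net.n - D.δ i) :=
  (D.Tu i)ᵀ ⊡ ∑ j, net.a i j • (xhat i - xhat j)

end ObserverDesign

/-- The matrices `K^ι` and `P` of the control law. -/
structure ControllerDesign (net : ControlNetwork) where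
  K : ∀ ι, Matrix (Fin (net.mc ι)) (Fin net.n) ℝ
  P : Matrix (Fin net.n) (Fin net.n) ℝ

/-- `P` is symmetric positive definite and
`(A + ∑ B^ι K^ι)ᵀ P + P (A + ∑ B^ι K^ι)` is negative definite. -/
def ControllerDesign.Lyapunov {net : ControlNetwork} (c : ControllerDesign net) : Prop :=
  c.P.PosDef ∧
    (-((net.A + ∑ ι, net.Bc ι * c.K ι)ᵀ * c.P + c.P * (net.A + ∑ ι, net.Bc ι * c.K ι))).PosDef

/-- The leakage coefficients `σ^ι, σ_i, σ_is`. -/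
structure Leakage (net : ControlNetwork) where
  β : Fin net.Nc → ℝ
  γ : Fin net.N → ℝ
  γs : Fin net.N → ℝ

/-- All leakage coefficients are positive. -/
def Leakage.Pos {net : ControlNetwork} (σ : Leakage net) : Prop :=
  (∀ ι, 0 < σ.β ι) ∧ (∀ i, 0 < σ.γ i) ∧ (∀ i, 0 < σ.γs i)

/-- The tunable parameters: the boundary layer width `ε` and the step sizes
`φ^ι, φ_i, φ_is`. -/
structure Tuning (net : ControlNetwork) where
  ε : ℝ
  β : Fin net.Nc → ℝ
  γ : Fin net.N → ℝ
  γs : Fin net.N → ℝ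

/-- All tunable parameters are positive. -/
def Tuning.Pos {net : ControlNetwork} (φ : Tuning net) : Prop :=
  0 < φ.ε ∧ (∀ ι, 0 < φ.β ι) ∧ (∀ i, 0 < φ.γ i) ∧ (∀ i, 0 < φ.γs i)

/-- The boundary-layer function `h_ε` for the gain `β`. -/
def boundaryLayer {k : ℕ} (ε β : ℝ) (ω : Vec k) : Vec k :=
  if ε < β * ‖ω‖ then ‖ω‖⁻¹ • ω else (β * ε⁻¹) • ω

/-- The unit vector function `h(ω) = ω / ‖ω‖`, made set-valued at its discontinuity: at `ω = 0`
every vector of the closed unit ball (in particular the value `h(0) = 0`) is admitted. -/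
def unitSet {k : ℕ} (ω : Vec k) : Set (Vec k) :=
  {w | if ω = 0 then ‖w‖ ≤ 1 else w = ‖ω‖⁻¹ • ω}

/-- The time-dependent variables of the closed loop: plant state, observer states and
adaptive gains. -/
structure Trajectory (net : ControlNetwork) where
  x : ℝ → Vec net.n
  z : Fin net.N → ℝ → Vec net.n
  β : Fin net.Nc → ℝ → ℝ
  γ : Fin net.N → ℝ → ℝ
  γs : Fin net.N → ℝ → ℝ

namespace Trajectory

variable {net : ControlNetwork}

/-- The state estimates `x̂_i(t)`. -/
def xhat (s : Trajectory net) (D : ObserverDesign net) (t : ℝ) (i : Fin net.N) : Vec net.n :=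
  D.estimate (s.x t) (fun j => s.z j t) i

/-- The state estimation errors `e_i(t) = x̂_i(t) - x(t)`. -/
def err (s : Trajectory net) (D : ObserverDesign net) (t : ℝ) (i : Fin net.N) : Vec net.n :=
  s.xhat D t i - s.x t

/-- `ε_iu(t)` -/
def dis (s : Trajectory net) (D : ObserverDesign net) (t : ℝ) (i : Fin net.N) :
    Vec (net.n - D.δ i) :=
  D.disagreement (s.xhat D t) i

/-- `(B^ι)ᵀ P x̂_{i'}(t)` with `i' = est ι`. -/
def sliding (s : Trajectory net) (D : ObserverDesign net) (c : ControllerDesign net) (t : ℝ)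
    (ι : Fin net.Nc) : Vec (net.mc ι) :=
  (net.Bc ι)ᵀ ⊡ c.P ⊡ s.xhat D t (net.est ι)

/-- The control law `u^ι = K^ι x̂_{i'} - β^ι h_ε((B^ι)ᵀ P x̂_{i'})`. -/
def input (s : Trajectory net) (D : ObserverDesign net) (c : ControllerDesign net) (ε : ℝ)
    (t : ℝ) (ι : Fin net.Nc) : Vec (net.mc ι) :=
  c.K ι ⊡ s.xhat D t (net.est ι)
    - s.β ι t • boundaryLayer ε (s.β ι t) (s.sliding D c t ι)

/-- `f` is absolutely continuous on every compact subinterval of `[0, T)`. -/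
def LocallyAC {X : Type*} [PseudoMetricSpace X] (f : ℝ → X) (T : EReal) : Prop :=
  ∀ b : ℝ, 0 ≤ b → (b : EReal) < T → AbsolutelyContinuousOnInterval f 0 b

/-- `s` is a solution on `[0, T)`, `0 < T ≤ ∞`, of the closed loop driven by the unknown input
`v`: it is locally absolutely continuous, satisfies the differential equations for almost all
times (with the set-valued version of the unit vector function, so that the sliding motions of
the observers are included), has `z_i(0) = 0` and positive initial gains. -/
structure IsSolution (s : Trajectory net) (D : ObserverDesign net) (c : ControllerDesign net)
    (σ : Leakage net) (φ : Tuning net) (v : ℝ → Vec net.mv) (T : EReal) : Prop where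
  ac_x : LocallyAC s.x T
  ac_z : ∀ i, LocallyAC (s.z i) T
  ac_β : ∀ ι, LocallyAC (s.β ι) T
  ac_γ : ∀ i, LocallyAC (s.γ i) T
  ac_γs : ∀ i, LocallyAC (s.γs i) T
  z_zero : ∀ i, s.z i 0 = 0
  β_pos : ∀ ι, 0 < s.β ι 0
  γ_pos : ∀ i, 0 < s.γ i 0
  γs_pos : ∀ i, 0 < s.γs i 0
  deriv_x : ∀ᵐ t : ℝ, 0 < t → (t : EReal) < T →
    HasDerivAt s.x (net.A ⊡ s.x t + (∑ ι, net.Bc ι ⊡ s.input D c φ.ε t ι) + net.Bv ⊡ v t) t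
  deriv_z : ∀ i, ∀ᵐ t : ℝ, 0 < t → (t : EReal) < T → ∃ w ∈ unitSet (s.dis D t i),
    HasDerivAt (s.z i)
      (D.Ebar i ⊡ s.z i t + D.Fbar i ⊡ net.C i ⊡ s.x t
        + D.Bbar i ⊡ net.localInput (s.input D c φ.ε t) i
        - (s.γ i t • D.Tu i ⊡ s.dis D t i + s.γs i t • D.Tu i ⊡ w)) t
  deriv_β : ∀ ι, ∀ᵐ t : ℝ, 0 < t → (t : EReal) < T →
    HasDerivAt (s.β ι) (-σ.β ι * s.β ι t + φ.β ι * ‖s.sliding D c t ι‖) t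
  deriv_γ : ∀ i, ∀ᵐ t : ℝ, 0 < t → (t : EReal) < T →
    HasDerivAt (s.γ i) (-σ.γ i * s.γ i t + φ.γ i * ‖s.dis D t i‖ ^ 2) t
  deriv_γs : ∀ i, ∀ᵐ t : ℝ, 0 < t → (t : EReal) < T →
    HasDerivAt (s.γs i) (-σ.γs i * s.γs i t + φ.γs i * ‖s.dis D t i‖) t

end Trajectory

end

open MeasureTheory Filter Topology

/-! One Lyapunov function serves the whole closed loop: `V = ⟨x, P x⟩ + energy(e) + k ∑ ⟨d_i, Q_i
d_i⟩` with `d_i = T_idᵀ e_i`, plus squared distances of the adaptive gains from reference values,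
weighted by the inverse step sizes. The heart is `V' ≤ -ρ V + residual`, proved pointwise in
`exists_dissipation`.

Four facts make it work. The component `d_i` evolves autonomously by `E_i`, because the observer
equations decouple it from the unavailable input (`error_velocity`); it is stable, or identically
zero for a static observer. The consensus terms damp the disagreements `ε_iu`, and connectivity with
collective detectability bounds `‖e‖²` by the disagreements and the `d_i` together
(`exists_norm_sq_le`). The unknown input is matched, so on the plant it is opposed by the adaptive
unit-vector feedback (`exists_plant_estimate`); on the observers its direct contribution is linear
in `‖ε_iu‖` and is opposed by `γ_is` (`exists_observer_estimate`). Finally, control with estimates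
instead of states produces products `β^ι ‖e‖`. Young's inequality pays for these with the leakage
`σ^ι / φ^ι`, at the price of a multiple of `(φ^ι / σ^ι) ‖e‖²`. Hence `k` and the reference for `γ_i`
depend on `φ^ι`, which is why the `φ_i` are chosen after the `φ^ι`; `ρ` and the coercivity constant
`a` of `V` do not.

Solutions are only absolutely continuous, so the inequality holds almost everywhere and is
integrated by `le_exp_of_ae_deriv_le`. Thus `V` falls at rate `ρ` to `residual / ρ`, the gains stay
bounded, and `𝓡` can be the ball of radius `√(residual / (ρ a))`; the residual is made small term by
term in `exists_residual_le`. -/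

noncomputable section

/-! ### Absolutely continuous functions and differential inequalities -/

namespace AbsolutelyContinuousOnInterval

theorem lipschitz_comp {X Y : Type*} [PseudoMetricSpace X] [PseudoMetricSpace Y] {K : NNReal}
    {F : X → Y} (hF : LipschitzWith K F) {f : ℝ → X} {a b : ℝ}
    (hf : AbsolutelyContinuousOnInterval f a b) :
    AbsolutelyContinuousOnInterval (fun t => F (f t)) a b := by
  unfold AbsolutelyContinuousOnInterval at hf ⊢
  refine squeeze_zero (fun t => Finset.sum_nonneg fun i _ => dist_nonneg) (fun t => ?_)
    (by simpa using hf.const_mul (K : ℝ))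
  rw [Finset.mul_sum]
  exact Finset.sum_le_sum fun i _ => hF.dist_le_mul _ _

theorem linear_comp {E F : Type*} [NormedAddCommGroup E] [NormedSpace ℝ E]
    [FiniteDimensional ℝ E] [NormedAddCommGroup F] [NormedSpace ℝ F] (L : E →ₗ[ℝ] F) {f : ℝ → E}
    {a b : ℝ} (hf : AbsolutelyContinuousOnInterval f a b) :
    AbsolutelyContinuousOnInterval (fun t => L (f t)) a b :=
  lipschitz_comp (LinearMap.toContinuousLinearMap L).lipschitz hf

theorem const {X : Type*} [PseudoMetricSpace X] (c : X) (a b : ℝ) :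
    AbsolutelyContinuousOnInterval (fun _ => c) a b :=
  ((LipschitzWith.const c).lipschitzOnWith (s := Set.uIcc a b)).absolutelyContinuousOnInterval

theorem finset_sum {ι F : Type*} [NormedAddCommGroup F] {f : ι → ℝ → F}
    {a b : ℝ} (s : Finset ι) (hf : ∀ i ∈ s, AbsolutelyContinuousOnInterval (f i) a b) :
    AbsolutelyContinuousOnInterval (fun t => ∑ i ∈ s, f i t) a b := by
  classical
  induction s using Finset.induction_on with
  | empty => simpa using const (0 : F) a b
  | insert i s hi ih =>
    simp only [Finset.sum_insert hi]
    exact (hf i (by simp)).fun_add (ih fun j hj => hf j (by simp [hj]))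

theorem norm_sq {F : Type*} [NormedAddCommGroup F] {f : ℝ → F}
    {a b : ℝ} (hf : AbsolutelyContinuousOnInterval f a b) :
    AbsolutelyContinuousOnInterval (fun t => ‖f t‖ ^ 2) a b := by
  have h := lipschitz_comp lipschitzWith_one_norm hf
  simpa only [sq] using h.fun_mul h

/-- Polarization reduces this to squared norms. -/
theorem inner {F : Type*} [NormedAddCommGroup F] [InnerProductSpace ℝ F] {f g : ℝ → F}
    {a b : ℝ} (hf : AbsolutelyContinuousOnInterval f a b)
    (hg : AbsolutelyContinuousOnInterval g a b) :
    AbsolutelyContinuousOnInterval (fun t => inner ℝ (f t) (g t)) a b := by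
  have h := ((hf.fun_add hg).norm_sq.fun_sub (hf.fun_sub hg).norm_sq).const_mul (1 / 4)
  have heq : (fun t => 1 / 4 * (‖f t + g t‖ ^ 2 - ‖f t - g t‖ ^ 2))
      = fun t => Inner.inner ℝ (f t) (g t) := by
    funext t
    rw [norm_add_sq_real, norm_sub_sq_real]
    ring
  rwa [heq] at h

/-- Absolute continuity gives the fundamental theorem of calculus, so a sign of the derivative
almost everywhere suffices; mere continuity would not (Cantor function). -/
theorem le_of_ae_deriv_nonpos {f : ℝ → ℝ} {b : ℝ} (hb : 0 ≤ b)
    (hf : AbsolutelyContinuousOnInterval f 0 b)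
    (h : ∀ᵐ t : ℝ, 0 < t → t < b → ∃ f', HasDerivAt f f' t ∧ f' ≤ 0) : f b ≤ f 0 := by
  have h1 := hf.integral_deriv_eq_sub
  have h2 : ∫ t in (0 : ℝ)..b, deriv f t ≤ 0 := by
    rw [intervalIntegral.integral_of_le hb]
    refine integral_nonpos_of_ae ?_
    rw [EventuallyLE, ae_restrict_iff' measurableSet_Ioc]
    have hne : ∀ᵐ t : ℝ, t ≠ b := by simp [ae_iff, measure_singleton]
    filter_upwards [h, hne] with t ht htb hmem
    obtain ⟨f', hd, hle⟩ := ht hmem.1 (lt_of_le_of_ne hmem.2 htb)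
    simpa [hd.deriv] using hle
  linarith

/-- Grönwall with integrating factor: `exp (k t) (f t - c / k)` has nonpositive derivative almost
everywhere. -/
theorem le_exp_of_ae_deriv_le {f : ℝ → ℝ} {b k c : ℝ} (hb : 0 ≤ b) (hk : 0 < k)
    (hf : AbsolutelyContinuousOnInterval f 0 b)
    (h : ∀ᵐ t : ℝ, 0 < t → t < b → ∃ f', HasDerivAt f f' t ∧ f' ≤ -k * f t + c) :
    f b ≤ Real.exp (-k * b) * (f 0 - c / k) + c / k := by
  have hexp : AbsolutelyContinuousOnInterval (fun t => Real.exp (k * t)) 0 b :=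
    ContDiffOn.absolutelyContinuousOnInterval (by fun_prop)
  have hg := hexp.fun_mul (hf.fun_sub (const (c / k) 0 b))
  have key := hg.le_of_ae_deriv_nonpos hb (by
    filter_upwards [h] with t ht h0 h1
    obtain ⟨f', hd, hle⟩ := ht h0 h1
    have he : HasDerivAt (fun t => Real.exp (k * t)) (Real.exp (k * t) * k) t := by
      simpa using ((hasDerivAt_id t).const_mul k).exp
    refine ⟨_, he.mul (hd.sub_const (c / k)), ?_⟩
    have : Real.exp (k * t) * k * (f t - c / k) + Real.exp (k * t) * f'
        = Real.exp (k * t) * (f' + k * f t - c) := by field_simp; ring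
    rw [this]
    exact mul_nonpos_of_nonneg_of_nonpos (Real.exp_pos _).le (by linarith))
  simp only [mul_zero, Real.exp_zero, one_mul] at key
  have h2 := mul_le_mul_of_nonneg_left key (Real.exp_pos (-k * b)).le
  rw [← mul_assoc, ← Real.exp_add] at h2
  simp only [neg_mul, neg_add_cancel, Real.exp_zero, one_mul] at h2
  rw [neg_mul]
  linarith

end AbsolutelyContinuousOnInterval

/-! ### Bounds for homogeneous functions in finite dimension -/

section Homogeneous

variable {E : Type*} [NormedAddCommGroup E] [NormedSpace ℝ E] [FiniteDimensional ℝ E]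

/-- The constant is the minimum over the compact unit sphere; scaling does the rest. If the sphere
is empty, the space is zero and any constant works. -/
theorem exists_lower_bound_of_homogeneous {f : E → ℝ} (hf : Continuous f)
    (hhom : ∀ (r : ℝ) x, f (r • x) = r ^ 2 * f x) (hpos : ∀ x, x ≠ 0 → 0 < f x) :
    ∃ c, 0 < c ∧ ∀ x, c * ‖x‖ ^ 2 ≤ f x := by
  have h0 : f 0 = 0 := by simpa using hhom 0 0
  rcases (Metric.sphere (0 : E) 1).eq_empty_or_nonempty with he | hne
  · refine ⟨1, one_pos, fun x => ?_⟩
    by_cases hx : x = 0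
    · simp [hx, h0]
    · have : ‖x‖⁻¹ • x ∈ Metric.sphere (0 : E) 1 := by
        simp [norm_smul, inv_mul_cancel₀ (norm_ne_zero_iff.2 hx)]
      simp [he] at this
  · obtain ⟨y, hy, hmin⟩ := (isCompact_sphere (0 : E) 1).exists_isMinOn hne hf.continuousOn
    have hy0 : y ≠ 0 := by
      rintro rfl
      simp at hy
    refine ⟨f y, hpos y hy0, fun x => ?_⟩
    by_cases hx : x = 0
    · simp [hx, h0]
    · have hxn := norm_ne_zero_iff.2 hx
      have hm : ‖x‖⁻¹ • x ∈ Metric.sphere (0 : E) 1 := by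
        simp [norm_smul, inv_mul_cancel₀ hxn]
      have h1 : f y ≤ f (‖x‖⁻¹ • x) := hmin hm
      have h2 : f x = ‖x‖ ^ 2 * f (‖x‖⁻¹ • x) := by
        rw [← hhom, smul_smul, mul_inv_cancel₀ hxn, one_smul]
      rw [h2, mul_comm]
      gcongr

theorem exists_upper_bound_of_homogeneous {f : E → ℝ} (hf : Continuous f)
    (hhom : ∀ (r : ℝ) x, f (r • x) = r ^ 2 * f x) :
    ∃ c, 0 < c ∧ ∀ x, f x ≤ c * ‖x‖ ^ 2 := by
  have h0 : f 0 = 0 := by simpa using hhom 0 0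
  obtain ⟨C, hC⟩ := (isCompact_sphere (0 : E) 1).exists_bound_of_continuousOn hf.continuousOn
  refine ⟨max C 1, by positivity, fun x => ?_⟩
  by_cases hx : x = 0
  · simp [hx, h0]
  · have hxn := norm_ne_zero_iff.2 hx
    have hm : ‖x‖⁻¹ • x ∈ Metric.sphere (0 : E) 1 := by
      simp [norm_smul, inv_mul_cancel₀ hxn]
    have h1 : f (‖x‖⁻¹ • x) ≤ max C 1 :=
      (le_abs_self _).trans ((hC _ hm).trans (le_max_left _ _))
    have h2 : f x = ‖x‖ ^ 2 * f (‖x‖⁻¹ • x) := by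
      rw [← hhom, smul_smul, mul_inv_cancel₀ hxn, one_smul]
    rw [h2, mul_comm]
    gcongr

theorem LinearMap.exists_norm_le {F : Type*} [NormedAddCommGroup F] [NormedSpace ℝ F]
    (L : E →ₗ[ℝ] F) : ∃ c, 0 < c ∧ ∀ x, ‖L x‖ ≤ c * ‖x‖ := by
  refine ⟨‖LinearMap.toContinuousLinearMap L‖ + 1, by positivity, fun x => ?_⟩
  have := (LinearMap.toContinuousLinearMap L).le_opNorm x
  have h2 := norm_nonneg x
  simp only [LinearMap.coe_toContinuousLinearMap'] at this
  linarith

end Homogeneous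

/-! ### Matrices acting on Euclidean vectors -/

section MatrixAction

variable {k l m : ℕ}

theorem mul_toEuclideanLin (M : Matrix (Fin k) (Fin l) ℝ) (M' : Matrix (Fin l) (Fin m) ℝ)
    (x : Vec m) : (M * M') ⊡ x = M ⊡ M' ⊡ x := by
  simp [Matrix.toLpLin_apply, Matrix.mulVec_mulVec]

theorem add_toEuclideanLin (M M' : Matrix (Fin k) (Fin l) ℝ) (x : Vec l) :
    (M + M') ⊡ x = M ⊡ x + M' ⊡ x := by
  simp

theorem sub_toEuclideanLin (M M' : Matrix (Fin k) (Fin l) ℝ) (x : Vec l) :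
    (M - M') ⊡ x = M ⊡ x - M' ⊡ x := by
  simp

theorem one_toEuclideanLin (x : Vec l) : (1 : Matrix (Fin l) (Fin l) ℝ) ⊡ x = x := by
  simp

theorem inner_toEuclideanLin_left (M : Matrix (Fin k) (Fin l) ℝ) (x : Vec l) (y : Vec k) :
    inner ℝ (M ⊡ x) y = inner ℝ x (Mᵀ ⊡ y) := by
  rw [← Matrix.conjTranspose_eq_transpose_of_trivial,
    Matrix.toEuclideanLin_conjTranspose_eq_adjoint, LinearMap.adjoint_inner_right]

theorem inner_toEuclideanLin_right (M : Matrix (Fin k) (Fin l) ℝ) (x : Vec k) (y : Vec l) :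
    inner ℝ x (M ⊡ y) = inner ℝ (Mᵀ ⊡ x) y := by
  rw [real_inner_comm, inner_toEuclideanLin_left, real_inner_comm]

theorem exists_norm_toEuclideanLin_le (M : Matrix (Fin k) (Fin l) ℝ) :
    ∃ c, 0 < c ∧ ∀ x : Vec l, ‖M ⊡ x‖ ≤ c * ‖x‖ :=
  LinearMap.exists_norm_le (Matrix.toEuclideanLin M)

theorem Matrix.PosDef.inner_pos {M : Matrix (Fin k) (Fin k) ℝ} (hM : M.PosDef) {x : Vec k}
    (hx : x ≠ 0) : 0 < inner ℝ x (M ⊡ x) := by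
  have h := hM.dotProduct_mulVec_pos (x := WithLp.ofLp x) (by
    intro h0
    exact hx (by ext i; simpa using congrFun h0 i))
  rw [EuclideanSpace.inner_eq_star_dotProduct, dotProduct_comm]
  simpa [Matrix.toLpLin_apply] using h

theorem Matrix.PosDef.exists_lower_bound {M : Matrix (Fin k) (Fin k) ℝ} (hM : M.PosDef) :
    ∃ c, 0 < c ∧ ∀ x : Vec k, c * ‖x‖ ^ 2 ≤ inner ℝ x (M ⊡ x) := by
  refine exists_lower_bound_of_homogeneous ?_ (fun r x => ?_) fun x hx => hM.inner_pos hx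
  · have := LinearMap.continuous_of_finiteDimensional (Matrix.toEuclideanLin M)
    fun_prop
  · rw [map_smul, inner_smul_left, inner_smul_right]
    simp
    ring

theorem exists_inner_toEuclideanLin_le (M : Matrix (Fin k) (Fin k) ℝ) :
    ∃ c, 0 < c ∧ ∀ x : Vec k, inner ℝ x (M ⊡ x) ≤ c * ‖x‖ ^ 2 := by
  obtain ⟨c, hc, h⟩ := exists_norm_toEuclideanLin_le M
  refine ⟨c, hc, fun x => (real_inner_le_norm _ _).trans ?_⟩
  nlinarith [h x, norm_nonneg x]

end MatrixAction

/-! ### Lyapunov matrices for Hurwitz matrices -/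

section Hurwitz

variable {k : ℕ}

/-- Since `‖1 + r μ‖² = 1 + 2 r Re μ + r² ‖μ‖²`, every sufficiently small `r > 0` works for one `μ`,
hence for finitely many. -/
theorem exists_pos_norm_one_add_mul_lt_one {s : Set ℂ} (hs : s.Finite) (h : ∀ μ ∈ s, μ.re < 0) :
    ∃ r : ℝ, 0 < r ∧ ∀ μ ∈ s, ‖1 + r * μ‖ < 1 := by
  have h1 : ∀ᶠ r : ℝ in 𝓝[>] 0, ∀ μ ∈ s, r * ‖μ‖ ^ 2 < -2 * μ.re := by
    rw [Filter.eventually_all_finite hs]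
    intro μ hμ
    have ht : Tendsto (fun r : ℝ => r * ‖μ‖ ^ 2) (𝓝[>] 0) (𝓝 (0 * ‖μ‖ ^ 2)) :=
      Tendsto.mono_left (Continuous.tendsto (by fun_prop) 0) nhdsWithin_le_nhds
    exact ht.eventually_lt_const (by have := h μ hμ; linarith)
  obtain ⟨r, hr, hpos⟩ := (h1.and self_mem_nhdsWithin).exists
  have hpos : 0 < r := hpos
  refine ⟨r, hpos, fun μ hμ => ?_⟩
  have h2 := hr μ hμ
  rw [← sq_lt_one_iff₀ (norm_nonneg _)]
  rw [← Complex.normSq_eq_norm_sq, Complex.normSq_apply] at h2 ⊢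
  simp only [Complex.add_re, Complex.one_re, Complex.mul_re, Complex.ofReal_re, Complex.ofReal_im,
    zero_mul, sub_zero, Complex.add_im, Complex.one_im, Complex.mul_im, add_zero, zero_add]
  nlinarith

attribute [local instance] Matrix.linftyOpNormedRing Matrix.linftyOpNormedAlgebra

/-- Gelfand's formula: the spectral radius is below some `r < 1`, so eventually `‖S ^ n‖ < r ^ n`.
-/
theorem tendsto_pow_of_spectrum_lt_one {S : Matrix (Fin k) (Fin k) ℂ}
    (h : ∀ μ ∈ spectrum ℂ S, ‖μ‖ < 1) : Tendsto (fun n => S ^ n) atTop (𝓝 0) := by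
  rcases isEmpty_or_nonempty (Fin k) with hk | hk
  · exact tendsto_const_nhds.congr fun n => Subsingleton.elim _ _
  · have hr : spectralRadius ℂ S < 1 := by
      have := spectrum.spectralRadius_lt_of_forall_lt S (r := 1) (fun μ hμ => by
        have := h μ hμ
        exact_mod_cast this)
      simpa using this
    obtain ⟨r, hr1, hr2⟩ := exists_between hr
    have ht := spectrum.pow_nnnorm_pow_one_div_tendsto_nhds_spectralRadius S
    have hev := ht.eventually_lt_const hr1
    have hrt : r ≠ ⊤ := (hr2.trans ENNReal.one_lt_top).ne
    lift r to NNReal using hrt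
    have hr2 : r < 1 := by exact_mod_cast hr2
    have hrn : Tendsto (fun n => (r : ℝ) ^ n) atTop (𝓝 0) :=
      tendsto_pow_atTop_nhds_zero_of_lt_one r.2 hr2
    refine squeeze_zero_norm' ?_ hrn
    filter_upwards [hev, eventually_gt_atTop 0] with n hn hn0
    rw [one_div, ENNReal.rpow_inv_lt_iff (by positivity), ENNReal.rpow_natCast] at hn
    have hn : ‖S ^ n‖₊ < r ^ n := by exact_mod_cast hn
    exact_mod_cast hn.le

/-- Instead of integrating matrix exponentials, pass to an Euler step `S = 1 + r M` with spectrum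
inside the unit disc. A finite sum of `(S ^ i)ᵀ S ^ i` is enough once some power of `S` contracts,
because the differences of `‖S ^ i x‖²` telescope. -/
theorem IsHurwitz.exists_lyapunov {M : Matrix (Fin k) (Fin k) ℝ} (hM : IsHurwitz M) :
    ∃ Q : Matrix (Fin k) (Fin k) ℝ, Qᵀ = Q ∧ (∃ c, 0 < c ∧ ∀ x : Vec k,
      c * ‖x‖ ^ 2 ≤ inner ℝ x (Q ⊡ x)) ∧
      ∀ x : Vec k, 2 * inner ℝ (Q ⊡ x) (M ⊡ x) ≤ -‖x‖ ^ 2 := by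
  obtain ⟨r, hr, hlt⟩ := exists_pos_norm_one_add_mul_lt_one
    (Module.End.finite_spectrum (Matrix.toLin' (M.map (algebraMap ℝ ℂ)))) (by
      rw [Matrix.spectrum_toLin']; exact hM)
  rw [Matrix.spectrum_toLin'] at hlt
  set S : Matrix (Fin k) (Fin k) ℝ := 1 + r • M with hS
  have hSC : Tendsto (fun n => (S.map (algebraMap ℝ ℂ)) ^ n) atTop (𝓝 0) := by
    refine tendsto_pow_of_spectrum_lt_one fun μ hμ => ?_
    have hSM : S.map (algebraMap ℝ ℂ) = algebraMap ℂ _ 1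
        + (Units.mk0 (r : ℂ) (by exact_mod_cast hr.ne')) • M.map (algebraMap ℝ ℂ) := by
      ext i j
      simp [hS, Matrix.one_apply, Units.smul_def]
      split_ifs <;> simp
    rw [hSM, ← spectrum.singleton_add_eq, spectrum.unit_smul_eq_smul] at hμ
    obtain ⟨_, rfl, _, ⟨ν, hν, rfl⟩, rfl⟩ := hμ
    exact hlt ν hν
  have hSR : Tendsto (fun n => S ^ n) atTop (𝓝 0) := by
    refine tendsto_pi_nhds.2 fun i => tendsto_pi_nhds.2 fun j => ?_
    have h1 := (tendsto_pi_nhds.1 ((tendsto_pi_nhds.1 hSC) i)) j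
    have h2 := (Complex.continuous_re.tendsto _).comp h1
    refine h2.congr fun n => ?_
    have hpow : (S.map (algebraMap ℝ ℂ)) ^ n = (S ^ n).map (algebraMap ℝ ℂ) :=
      (map_pow (algebraMap ℝ ℂ).mapMatrix S n).symm
    rw [Function.comp_apply, hpow]
    simp
  -- The exponent `n + 1` ensures that the sum below contains `i = 0`, whose identity matrix gives
  -- positivity.
  have hev : ∃ n, ∀ x : Vec k, ‖(S ^ (n + 1)) ⊡ x‖ ^ 2 ≤ 1 / 2 * ‖x‖ ^ 2 := by
    set Λ : Matrix (Fin k) (Fin k) ℝ →ₗ[ℝ] (Vec k →L[ℝ] Vec k) :=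
      (LinearMap.toContinuousLinearMap (𝕜 := ℝ) (E := Vec k) (F' := Vec k)).toLinearMap
        ∘ₗ (Matrix.toEuclideanLin (𝕜 := ℝ) (m := Fin k) (n := Fin k)).toLinearMap with hΛ
    have hc : Continuous Λ := LinearMap.continuous_of_finiteDimensional Λ
    have ht := (((hc.tendsto 0).comp hSR).comp (tendsto_add_atTop_nat 1)).norm
    simp only [map_zero, norm_zero] at ht
    obtain ⟨n, hn⟩ := (ht.eventually_lt_const (u := 1 / 2) (by norm_num)).exists
    refine ⟨n, fun x => ?_⟩
    have h1 : ‖(S ^ (n + 1)) ⊡ x‖ ≤ ‖Λ (S ^ (n + 1))‖ * ‖x‖ := (Λ (S ^ (n + 1))).le_opNorm x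
    have hn : ‖Λ (S ^ (n + 1))‖ < 1 / 2 := hn
    have h2 : ‖(S ^ (n + 1)) ⊡ x‖ ≤ 1 / 2 * ‖x‖ :=
      h1.trans (mul_le_mul_of_nonneg_right hn.le (norm_nonneg _))
    nlinarith [norm_nonneg ((S ^ (n + 1)) ⊡ x), norm_nonneg x]
  obtain ⟨n, hn⟩ := hev
  set Q₀ : Matrix (Fin k) (Fin k) ℝ := ∑ i ∈ Finset.range (n + 1), (S ^ i)ᵀ * S ^ i with hQ₀
  have hQin : ∀ x y : Vec k, inner ℝ x (Q₀ ⊡ y)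
      = ∑ i ∈ Finset.range (n + 1), inner ℝ ((S ^ i) ⊡ x) ((S ^ i) ⊡ y) := by
    intro x y
    rw [hQ₀, map_sum, LinearMap.sum_apply, inner_sum]
    refine Finset.sum_congr rfl fun i _ => ?_
    rw [mul_toEuclideanLin, inner_toEuclideanLin_left]
  -- Telescoping yields `2 r ⟨Q₀ x, M x⟩ ≤ -‖x‖² / 2`, after the nonnegative `r²` terms are dropped;
  -- the factor `2 r` normalizes this to `-‖x‖²`.
  refine ⟨(2 * r) • Q₀, ?_, ⟨2 * r, by positivity, fun x => ?_⟩, fun x => ?_⟩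
  · simp [hQ₀, Matrix.transpose_sum]
  · rw [map_smul, LinearMap.smul_apply, inner_smul_right, hQin]
    gcongr
    rw [Finset.sum_range_succ']
    simp only [real_inner_self_eq_norm_sq, pow_zero, one_toEuclideanLin]
    have : 0 ≤ ∑ i ∈ Finset.range n, ‖(S ^ (i + 1)) ⊡ x‖ ^ 2 :=
      Finset.sum_nonneg fun i _ => by positivity
    linarith
  · have hstep : ∀ i, ‖(S ^ (i + 1)) ⊡ x‖ ^ 2 - ‖(S ^ i) ⊡ x‖ ^ 2
        = 2 * r * inner ℝ ((S ^ i) ⊡ x) ((S ^ i) ⊡ M ⊡ x) + r ^ 2 * ‖(S ^ i) ⊡ M ⊡ x‖ ^ 2 := by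
      intro i
      have h1 : (S ^ (i + 1)) ⊡ x = (S ^ i) ⊡ x + r • (S ^ i) ⊡ M ⊡ x := by
        rw [pow_succ, mul_toEuclideanLin]
        nth_rewrite 2 [hS]
        rw [add_toEuclideanLin, one_toEuclideanLin, map_smul, LinearMap.smul_apply, map_add,
          map_smul]
      rw [h1, norm_add_sq_real, inner_smul_right, norm_smul, mul_pow, Real.norm_eq_abs, sq_abs]
      ring
    have htel := Finset.sum_range_sub (fun i => ‖(S ^ i) ⊡ x‖ ^ 2) (n + 1)
    simp only [hstep, Finset.sum_add_distrib, ← Finset.mul_sum, pow_zero,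
      one_toEuclideanLin] at htel
    have hnn : 0 ≤ ∑ i ∈ Finset.range (n + 1), ‖(S ^ i) ⊡ M ⊡ x‖ ^ 2 :=
      Finset.sum_nonneg fun i _ => by positivity
    rw [map_smul, LinearMap.smul_apply, inner_smul_left, real_inner_comm, hQin]
    simp only [real_inner_comm ((S ^ _) ⊡ x) ((S ^ _) ⊡ M ⊡ x), conj_trivial]
    have hx := hn x
    have hr2 := mul_nonneg (sq_nonneg r) hnn
    nlinarith

end Hurwitz

/-! ### Graph Laplacian, disagreement energy and collective detectability -/

section Graph

variable {net : ControlNetwork}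

/-- The graph Laplacian applied to a family of vectors. -/
def ControlNetwork.lap (net : ControlNetwork) (e : Fin net.N → Vec net.n) (i : Fin net.N) :
    Vec net.n :=
  ∑ j, net.a i j • (e i - e j)

/-- Summation by parts: by symmetry of the weights, exchanging `i` and `j` flips the sign of `e i -
e j`, so averaging the two forms replaces `f i` by `f i - f j`. -/
theorem ControlNetwork.ConnectedGraph.two_mul_sum_inner_lap (hg : net.ConnectedGraph)
    (e f : Fin net.N → Vec net.n) :
    2 * ∑ i, inner ℝ (net.lap e i) (f i)
      = ∑ i, ∑ j, net.a i j * inner ℝ (e i - e j) (f i - f j) := by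
  have h1 : ∑ i, inner ℝ (net.lap e i) (f i)
      = ∑ i, ∑ j, net.a i j * inner ℝ (e i - e j) (f i) := by
    simp only [ControlNetwork.lap, sum_inner, inner_smul_left, conj_trivial]
  have h2 : ∑ i, ∑ j, net.a i j * inner ℝ (e i - e j) (f i)
      = ∑ i, ∑ j, -(net.a i j * inner ℝ (e i - e j) (f j)) := by
    rw [Finset.sum_comm]
    refine Finset.sum_congr rfl fun i _ => Finset.sum_congr rfl fun j _ => ?_
    rw [hg.symm j i, ← neg_sub (e i) (e j), inner_neg_left]
    ring
  rw [two_mul, h1]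
  nth_rewrite 2 [h2]
  rw [← Finset.sum_add_distrib]
  refine Finset.sum_congr rfl fun i _ => ?_
  rw [← Finset.sum_add_distrib]
  refine Finset.sum_congr rfl fun j _ => ?_
  rw [inner_sub_right]
  ring

/-- The disagreement energy of a family of vectors. -/
def ControlNetwork.energy (net : ControlNetwork) (e : Fin net.N → Vec net.n) : ℝ :=
  1 / 2 * ∑ i, inner ℝ (net.lap e i) (e i)

theorem ControlNetwork.ConnectedGraph.energy_eq (hg : net.ConnectedGraph)
    (e : Fin net.N → Vec net.n) :
    net.energy e = 1 / 4 * ∑ i, ∑ j, net.a i j * ‖e i - e j‖ ^ 2 := by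
  have := hg.two_mul_sum_inner_lap e e
  simp only [real_inner_self_eq_norm_sq] at this
  rw [ControlNetwork.energy, ← this]
  ring

theorem ControlNetwork.ConnectedGraph.energy_nonneg (hg : net.ConnectedGraph)
    (e : Fin net.N → Vec net.n) : 0 ≤ net.energy e := by
  rw [hg.energy_eq]
  have := hg.nonneg
  exact mul_nonneg (by norm_num) (Finset.sum_nonneg fun i _ => Finset.sum_nonneg fun j _ =>
    mul_nonneg (this i j) (by positivity))

/-- Every summand of the energy vanishes, so `e` agrees across each edge and then along a walk. -/
theorem ControlNetwork.ConnectedGraph.eq_of_energy_eq_zero (hg : net.ConnectedGraph)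
    {e : Fin net.N → Vec net.n} (h : net.energy e = 0) (i j : Fin net.N) : e i = e j := by
  rw [hg.energy_eq] at h
  have hnn : ∀ i j, 0 ≤ net.a i j * ‖e i - e j‖ ^ 2 := fun i j =>
    mul_nonneg (hg.nonneg i j) (by positivity)
  have h1 : ∑ i, ∑ j, net.a i j * ‖e i - e j‖ ^ 2 = 0 := by linarith
  have h2 : ∀ i j, net.a i j * ‖e i - e j‖ ^ 2 = 0 := fun i j =>
    (Finset.sum_eq_zero_iff_of_nonneg fun j _ => hnn i j).1
      ((Finset.sum_eq_zero_iff_of_nonneg fun i _ => Finset.sum_nonneg fun j _ => hnn i j).1 h1 i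
        (Finset.mem_univ _)) j (Finset.mem_univ _)
  have h3 : ∀ i j, 0 < net.a i j → e i = e j := fun i j hij => by
    have := h2 i j
    simpa [hij.ne', sub_eq_zero] using this
  obtain ⟨w⟩ := hg.connected.preconnected i j
  induction w with
  | nil => rfl
  | cons hadj _ ih =>
    refine Eq.trans ?_ ih
    rw [SimpleGraph.fromRel_adj] at hadj
    rcases hadj.2 with h | h
    · exact h3 _ _ h
    · exact (h3 _ _ h).symm

/-- Such a `ξ` is orthogonal to every `Im T_id`, hence to their sum, which is everything. -/
theorem ObserverDesign.CollectivelyDetectable.eq_zero {D : ObserverDesign net}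
    (hD : D.CollectivelyDetectable) {ξ : Vec net.n} (h : ∀ i, (D.Td i)ᵀ ⊡ ξ = 0) : ξ = 0 := by
  have hle : ⨆ i, LinearMap.range (D.Td i).mulVecLin
      ≤ LinearMap.ker ((innerₛₗ ℝ ξ) ∘ₗ (WithLp.linearEquiv 2 ℝ (Fin net.n → ℝ)).symm.toLinearMap) := by
    refine iSup_le fun i => ?_
    rintro _ ⟨y, rfl⟩
    have h1 := inner_toEuclideanLin_right (D.Td i) ξ (WithLp.toLp 2 y)
    rw [h i, inner_zero_left] at h1
    simpa [Matrix.toLpLin_apply] using h1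
  rw [hD] at hle
  have := hle (Submodule.mem_top (x := WithLp.ofLp ξ))
  simpa using this

theorem ControlNetwork.ConnectedGraph.eq_zero_of_energy_eq_zero (hg : net.ConnectedGraph)
    {D : ObserverDesign net} (hD : D.CollectivelyDetectable) {e : Fin net.N → Vec net.n}
    (h : net.energy e = 0) (hd : ∀ i, (D.Td i)ᵀ ⊡ e i = 0) : e = 0 := by
  have heq := hg.eq_of_energy_eq_zero h
  funext i
  exact hD.eq_zero fun j => by rw [heq i j, hd j]

theorem ControlNetwork.lap_smul (r : ℝ) (e : Fin net.N → Vec net.n) (i : Fin net.N) :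
    net.lap (r • e) i = r • net.lap e i := by
  simp only [ControlNetwork.lap, Pi.smul_apply, ← smul_sub, Finset.smul_sum]
  exact Finset.sum_congr rfl fun j _ => smul_comm _ _ _

theorem ControlNetwork.energy_smul (r : ℝ) (e : Fin net.N → Vec net.n) :
    net.energy (r • e) = r ^ 2 * net.energy e := by
  simp only [ControlNetwork.energy, ControlNetwork.lap_smul, Pi.smul_apply, inner_smul_left,
    inner_smul_right, conj_trivial, ← Finset.mul_sum]
  ring

theorem ControlNetwork.continuous_lap (i : Fin net.N) :
    Continuous fun e : Fin net.N → Vec net.n => net.lap e i := by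
  unfold ControlNetwork.lap
  fun_prop

theorem ControlNetwork.continuous_energy :
    Continuous fun e : Fin net.N → Vec net.n => net.energy e := by
  have := net.continuous_lap
  unfold ControlNetwork.energy
  fun_prop

theorem continuous_toEuclideanLin {k l : ℕ} (M : Matrix (Fin k) (Fin l) ℝ) :
    Continuous (Matrix.toEuclideanLin M) :=
  LinearMap.continuous_of_finiteDimensional _

theorem ControlNetwork.exists_energy_le (net : ControlNetwork) :
    ∃ c, 0 < c ∧ ∀ e : Fin net.N → Vec net.n, net.energy e ≤ c * ‖e‖ ^ 2 :=
  exists_upper_bound_of_homogeneous net.continuous_energy net.energy_smul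

theorem ControlNetwork.exists_norm_lap_le (net : ControlNetwork) :
    ∃ c, 0 < c ∧ ∀ (e : Fin net.N → Vec net.n) i, ‖net.lap e i‖ ≤ c * ‖e‖ := by
  obtain ⟨c, hc, h⟩ := exists_upper_bound_of_homogeneous
    (f := fun e : Fin net.N → Vec net.n => ∑ i, ‖net.lap e i‖ ^ 2) (by
      have := net.continuous_lap
      fun_prop) (fun r e => by
      simp only [ControlNetwork.lap_smul, norm_smul, mul_pow, Real.norm_eq_abs, sq_abs,
        Finset.mul_sum])
  refine ⟨c + 1, by positivity, fun e i => ?_⟩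
  have h1 : ‖net.lap e i‖ ^ 2 ≤ c * ‖e‖ ^ 2 := le_trans
    (Finset.single_le_sum (f := fun i => ‖net.lap e i‖ ^ 2) (fun i _ => by positivity)
      (Finset.mem_univ i)) (h e)
  refine abs_le_of_sq_le_sq' (h1.trans ?_) (by positivity) |>.2
  rw [mul_pow]
  gcongr
  nlinarith

variable {D : ObserverDesign net}

/-- This makes the error part of the Lyapunov function coercive: the energy alone vanishes on
consensus, where collective detectability takes over. -/
theorem ControlNetwork.ConnectedGraph.exists_energy_add_lower_bound (hg : net.ConnectedGraph)
    (hD : D.CollectivelyDetectable) :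
    ∃ c, 0 < c ∧ ∀ e : Fin net.N → Vec net.n,
      c * ‖e‖ ^ 2 ≤ net.energy e + ∑ i, ‖(D.Td i)ᵀ ⊡ e i‖ ^ 2 := by
  refine exists_lower_bound_of_homogeneous ?_ (fun r e => ?_) fun e he => ?_
  · have h1 := net.continuous_energy
    have h2 := fun i => continuous_toEuclideanLin (D.Td i)ᵀ
    fun_prop
  · simp only [ControlNetwork.energy_smul, Pi.smul_apply, map_smul, norm_smul, mul_pow,
      Real.norm_eq_abs, sq_abs, Finset.mul_sum, mul_add]
  · have hnn : ∀ i, 0 ≤ ‖(D.Td i)ᵀ ⊡ e i‖ ^ 2 := fun i => by positivity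
    have h1 := hg.energy_nonneg e
    have h2 := Finset.sum_nonneg fun i (_ : i ∈ Finset.univ) => hnn i
    refine lt_of_le_of_ne (add_nonneg h1 h2) fun h0 => he ?_
    refine hg.eq_zero_of_energy_eq_zero hD (by linarith) fun i => ?_
    have h3 := (Finset.sum_eq_zero_iff_of_nonneg fun i _ => hnn i).1
      (by linarith : ∑ i, ‖(D.Td i)ᵀ ⊡ e i‖ ^ 2 = 0) i (Finset.mem_univ i)
    simpa using h3

/-- `T_id T_idᵀ + T_iu T_iuᵀ = 1` -/
theorem ObserverDesign.Admissible.inner_split (hA : D.Admissible) (i : Fin net.N)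
    (x y : Vec net.n) :
    inner ℝ x y = inner ℝ ((D.Td i)ᵀ ⊡ x) ((D.Td i)ᵀ ⊡ y)
      + inner ℝ ((D.Tu i)ᵀ ⊡ x) ((D.Tu i)ᵀ ⊡ y) := by
  rw [inner_toEuclideanLin_left, inner_toEuclideanLin_left, ← inner_add_right,
    Matrix.transpose_transpose, Matrix.transpose_transpose, ← mul_toEuclideanLin,
    ← mul_toEuclideanLin, ← add_toEuclideanLin, hA.Tu_proj i, add_sub_cancel, one_toEuclideanLin]

/-- The quantities that are actually damped control the full error. If they all vanish, splitting
`⟨lap e i, e i⟩` along `T_id` and `T_iu` shows that the energy vanishes, so `e` is a consensus in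
the kernel of every `T_idᵀ`, hence zero. Compactness turns this into an inequality. -/
theorem ControlNetwork.ConnectedGraph.exists_norm_sq_le (hg : net.ConnectedGraph)
    (hA : D.Admissible) (hD : D.CollectivelyDetectable) :
    ∃ κ, 0 < κ ∧ ∀ e : Fin net.N → Vec net.n,
      ‖e‖ ^ 2 ≤ κ * (∑ i, ‖(D.Tu i)ᵀ ⊡ net.lap e i‖ ^ 2 + ∑ i, ‖(D.Td i)ᵀ ⊡ e i‖ ^ 2) := by
  obtain ⟨c, hc, h⟩ := exists_lower_bound_of_homogeneous
    (f := fun e : Fin net.N → Vec net.n =>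
      ∑ i, ‖(D.Tu i)ᵀ ⊡ net.lap e i‖ ^ 2 + ∑ i, ‖(D.Td i)ᵀ ⊡ e i‖ ^ 2) (by
      have h1 := net.continuous_lap
      have h2 := fun i => continuous_toEuclideanLin (D.Td i)ᵀ
      have h3 := fun i => continuous_toEuclideanLin (D.Tu i)ᵀ
      fun_prop) (fun r e => by
      simp only [ControlNetwork.lap_smul, Pi.smul_apply, map_smul, norm_smul, mul_pow,
        Real.norm_eq_abs, sq_abs, Finset.mul_sum, mul_add]) (fun e he => by
      have hnn1 : ∀ i, 0 ≤ ‖(D.Tu i)ᵀ ⊡ net.lap e i‖ ^ 2 := fun i => by positivity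
      have hnn2 : ∀ i, 0 ≤ ‖(D.Td i)ᵀ ⊡ e i‖ ^ 2 := fun i => by positivity
      have h1 := Finset.sum_nonneg fun i (_ : i ∈ Finset.univ) => hnn1 i
      have h2 := Finset.sum_nonneg fun i (_ : i ∈ Finset.univ) => hnn2 i
      refine lt_of_le_of_ne (add_nonneg h1 h2) fun h0 => he ?_
      have h3 : ∀ i, (D.Tu i)ᵀ ⊡ net.lap e i = 0 := fun i => by
        simpa using (Finset.sum_eq_zero_iff_of_nonneg fun i _ => hnn1 i).1
          (by linarith : ∑ i, ‖(D.Tu i)ᵀ ⊡ net.lap e i‖ ^ 2 = 0) i (Finset.mem_univ i)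
      have h4 : ∀ i, (D.Td i)ᵀ ⊡ e i = 0 := fun i => by
        simpa using (Finset.sum_eq_zero_iff_of_nonneg fun i _ => hnn2 i).1
          (by linarith : ∑ i, ‖(D.Td i)ᵀ ⊡ e i‖ ^ 2 = 0) i (Finset.mem_univ i)
      refine hg.eq_zero_of_energy_eq_zero hD ?_ h4
      rw [ControlNetwork.energy, Finset.sum_eq_zero fun i _ => ?_, mul_zero]
      rw [hA.inner_split i, h3 i, h4 i, inner_zero_left, inner_zero_right, add_zero])
  refine ⟨c⁻¹, by positivity, fun e => ?_⟩
  rw [inv_mul_eq_div, le_div_iff₀ hc, mul_comm]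
  exact h e

end Graph

/-! ### Matching of the unknown input -/

section Matching

variable {net : ControlNetwork}

/-- The unknown input acts as a bounded disturbance in each control channel. Channel inputs are
chosen for the standard basis vectors and combined linearly in `v`, which gives the bound. -/
theorem ControlNetwork.WellPosed.exists_matched (hnet : net.WellPosed) (hm : net.Matched) :
    ∃ c, 0 < c ∧ ∀ v : Vec net.mv, ∃ w : ∀ ι, Vec (net.mc ι),
      net.Bv ⊡ v = ∑ ι, net.Bc ι ⊡ w ι ∧ ∀ ι, ‖w ι‖ ≤ c * ‖v‖ := by
  obtain ⟨Xv, hXv⟩ := hm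
  set Λ : (∀ ι, Vec (net.mc ι)) →ₗ[ℝ] Vec net.n :=
    ∑ ι, Matrix.toEuclideanLin (net.Bc ι) ∘ₗ LinearMap.proj ι with hΛ
  have hΛa : ∀ w, Λ w = ∑ ι, net.Bc ι ⊡ w ι := fun w => by simp [hΛ, LinearMap.sum_apply]
  have hle : ⨆ ι, LinearMap.range (net.Bc ι).mulVecLin
      ≤ (LinearMap.range Λ).map (WithLp.linearEquiv 2 ℝ (Fin net.n → ℝ)).toLinearMap := by
    refine iSup_le fun ι => ?_
    rintro _ ⟨y, rfl⟩
    refine ⟨net.Bc ι ⊡ WithLp.toLp 2 y, ⟨Pi.single ι (WithLp.toLp 2 y), ?_⟩, ?_⟩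
    · rw [hΛa, Finset.sum_eq_single ι]
      · simp
      · intro κ _ hκ
        simp [Pi.single_eq_of_ne hκ]
      · simp
    · simp [Matrix.toLpLin_apply]
  rw [← hnet.split_control] at hle
  have hex : ∀ v : Vec net.mv, ∃ w, Λ w = net.Bv ⊡ v := by
    intro v
    obtain ⟨_, ⟨w, rfl⟩, hw⟩ := hle ⟨Xv *ᵥ WithLp.ofLp v, rfl⟩
    refine ⟨w, ?_⟩
    apply (WithLp.linearEquiv 2 ℝ (Fin net.n → ℝ)).injective
    refine hw.trans ?_
    simp [← hXv, Matrix.toLpLin_apply]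
  choose w hw using fun j => hex (EuclideanSpace.single j (1 : ℝ))
  refine ⟨∑ j, ‖w j‖ + 1, by positivity, fun v => ⟨∑ j, v j • w j, ?_, fun ι => ?_⟩⟩
  · have hv : v = ∑ j, v j • EuclideanSpace.single j (1 : ℝ) := by
      ext i
      simp [Pi.single_apply]
    rw [← hΛa, map_sum]
    simp only [map_smul, hw]
    nth_rewrite 1 [hv]
    rw [map_sum]
    simp only [map_smul]
  · have h1 : ‖∑ j, v j • w j‖ ≤ ∑ j, ‖v‖ * ‖w j‖ := by
      refine (norm_sum_le _ _).trans (Finset.sum_le_sum fun j _ => ?_)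
      rw [norm_smul]
      gcongr
      exact PiLp.norm_apply_le v j
    refine (norm_le_pi_norm _ ι).trans (h1.trans ?_)
    rw [← Finset.mul_sum]
    nlinarith [norm_nonneg v]

end Matching

/-! ### Pointwise estimates for the plant and the observers -/

section

theorem exists_uniform_bound {ι : Type*} [Fintype ι] {p : ι → ℝ → Prop}
    (hmono : ∀ i a b, a ≤ b → p i a → p i b) (h : ∀ i, ∃ c, p i c) : ∃ c, 0 < c ∧ ∀ i, p i c := by
  choose c hc using h
  refine ⟨∑ i, |c i| + 1, by positivity, fun i => hmono i (c i) _ ?_ (hc i)⟩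
  have := Finset.single_le_sum (f := fun i => |c i|) (fun i _ => abs_nonneg _) (Finset.mem_univ i)
  have := le_abs_self (c i)
  linarith

theorem exists_uniform_lower_bound {ι : Type*} [Finite ι] {p : ι → ℝ → Prop}
    (hmono : ∀ i a b, a ≤ b → p i b → p i a) (h : ∀ i, ∃ c, 0 < c ∧ p i c) :
    ∃ c, 0 < c ∧ ∀ i, p i c := by
  choose c hc hp using h
  rcases isEmpty_or_nonempty ι with _ | _
  · exact ⟨1, one_pos, fun i => isEmptyElim i⟩
  · obtain ⟨j, hj⟩ := Finite.exists_min c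
    exact ⟨c j, hc j, fun i => hmono i _ _ (hj i) (hp i)⟩

section BoundaryLayer

variable {k : ℕ} {ε β : ℝ}

theorem norm_boundaryLayer_le (hε : 0 < ε) (hβ : 0 ≤ β) (ω : Vec k) :
    ‖boundaryLayer ε β ω‖ ≤ 1 := by
  unfold boundaryLayer
  split_ifs with h
  · rw [norm_smul, norm_inv, norm_norm]
    exact inv_mul_le_one
  · rw [norm_smul, norm_mul, Real.norm_of_nonneg hβ, norm_inv, Real.norm_of_nonneg hε.le,
      mul_right_comm, ← div_eq_mul_inv, div_le_one hε]
    exact not_lt.1 h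

/-- Smoothing the unit vector costs at most `ε`: outside the layer nothing is lost, inside it the
left side is nonpositive and the right side nonnegative. -/
theorem le_mul_inner_boundaryLayer (hε : 0 < ε) (hβ : 0 ≤ β) (ω : Vec k) :
    β * ‖ω‖ - ε ≤ β * inner ℝ ω (boundaryLayer ε β ω) := by
  unfold boundaryLayer
  split_ifs with h
  · rw [inner_smul_right, real_inner_self_eq_norm_sq]
    have h0 : ‖ω‖ ≠ 0 := by
      intro h0
      rw [h0, mul_zero] at h
      exact absurd h hε.not_gt
    have : ‖ω‖⁻¹ * ‖ω‖ ^ 2 = ‖ω‖ := by field_simp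
    rw [this]
    linarith
  · rw [inner_smul_right, real_inner_self_eq_norm_sq]
    have : 0 ≤ β * (β * ε⁻¹ * ‖ω‖ ^ 2) := by positivity
    linarith [not_lt.1 h]

end BoundaryLayer

/-- At `ω = 0` both sides vanish whatever `w` is, so sliding motions need no separate treatment. -/
theorem inner_eq_norm_of_mem_unitSet {k : ℕ} {ω w : Vec k} (h : w ∈ unitSet ω) :
    inner ℝ ω w = ‖ω‖ := by
  by_cases h0 : ω = 0
  · simp [h0]
  · have hw : w = ‖ω‖⁻¹ • ω := by simpa [unitSet, h0] using h
    have hn := norm_ne_zero_iff.2 h0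
    rw [hw, inner_smul_right, real_inner_self_eq_norm_sq]
    field_simp

variable {net : ControlNetwork}

/-- The control law as a function of the state estimates and the gains. -/
def ControllerDesign.feedback (c : ControllerDesign net) (ε : ℝ) (β : Fin net.Nc → ℝ)
    (xh : Fin net.N → Vec net.n) (ι : Fin net.Nc) : Vec (net.mc ι) :=
  c.K ι ⊡ xh (net.est ι)
    - β ι • boundaryLayer ε (β ι) ((net.Bc ι)ᵀ ⊡ c.P ⊡ xh (net.est ι))

/-- The part of the total input of the plant which is not available to the observer node `i`. -/
def ControlNetwork.hiddenInput (net : ControlNetwork) (u : ∀ ι, Vec (net.mc ι)) (v : Vec net.mv)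
    (i : Fin net.N) : Vec net.n :=
  (∑ ι, net.Bc ι ⊡ u ι) + net.Bv ⊡ v - net.Bl i ⊡ net.localInput u i

theorem ControlNetwork.exists_norm_hiddenInput_le (net : ControlNetwork) :
    ∃ b, 0 < b ∧ ∀ i u v, ‖net.hiddenInput u v i‖ ≤ b * (∑ ι, ‖u ι‖ + ‖v‖) := by
  have hnn : ∀ (u : ∀ ι, Vec (net.mc ι)) (v : Vec net.mv), 0 ≤ ∑ ι, ‖u ι‖ + ‖v‖ := fun u v =>
    add_nonneg (Finset.sum_nonneg fun i _ => norm_nonneg _) (norm_nonneg _)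
  have h := exists_uniform_bound (p := fun i b => ∀ u v,
    ‖net.hiddenInput u v i‖ ≤ b * (∑ ι, ‖u ι‖ + ‖v‖))
    (fun i a b hab h u v => (h u v).trans (mul_le_mul_of_nonneg_right hab (hnn u v)))
    (fun i => by
      set L : ((∀ ι, Vec (net.mc ι)) × Vec net.mv) →ₗ[ℝ] Vec net.n :=
        { toFun := fun p => net.hiddenInput p.1 p.2 i
          map_add' := fun p q => by
            simp only [ControlNetwork.hiddenInput, ControlNetwork.localInput, Prod.fst_add,
              Prod.snd_add, Pi.add_apply, map_add, Finset.sum_add_distrib]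
            abel
          map_smul' := fun r p => by
            simp only [ControlNetwork.hiddenInput, ControlNetwork.localInput, Prod.smul_fst,
              Prod.smul_snd, Pi.smul_apply, map_smul, ← Finset.smul_sum, RingHom.id_apply,
              smul_add, smul_sub] }
      obtain ⟨b, hb, h⟩ := L.exists_norm_le
      refine ⟨b, fun u v => (h (u, v)).trans ?_⟩
      gcongr
      rw [Prod.norm_def, max_le_iff]
      have h0 : ∀ ι, ‖u ι‖ ≤ ∑ ι, ‖u ι‖ := fun ι =>
        Finset.single_le_sum (f := fun ι => ‖u ι‖) (fun _ _ => norm_nonneg _) (Finset.mem_univ ι)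
      refine ⟨?_, le_add_of_nonneg_left (Finset.sum_nonneg fun i _ => norm_nonneg _)⟩
      refine (pi_norm_le_iff_of_nonneg (hnn u v)).2 fun ι => ?_
      exact (h0 ι).trans (le_add_of_nonneg_right (norm_nonneg _)))
  exact h

theorem ControllerDesign.exists_norm_feedback_le (c : ControllerDesign net) :
    ∃ b, 0 < b ∧ ∀ (ε : ℝ) (β : Fin net.Nc → ℝ) (x : Vec net.n) (xh : Fin net.N → Vec net.n),
      0 < ε → (∀ ι, 0 ≤ β ι) →
      ∀ ι, ‖c.feedback ε β xh ι‖ ≤ b * (‖x‖ + ‖fun i => xh i - x‖) + β ι := by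
  obtain ⟨b, hb, h⟩ := exists_uniform_bound (p := fun ι b => ∀ x : Vec net.n,
    ‖c.K ι ⊡ x‖ ≤ b * ‖x‖)
    (fun i a b hab h x => (h x).trans (mul_le_mul_of_nonneg_right hab (norm_nonneg _)))
    (fun ι => by
      obtain ⟨b, -, h⟩ := exists_norm_toEuclideanLin_le (c.K ι)
      exact ⟨b, h⟩)
  refine ⟨b, hb, fun ε β x xh hε hβ ι => (norm_sub_le _ _).trans (add_le_add ?_ ?_)⟩
  · refine (h ι _).trans ?_
    gcongr
    have h1 := norm_le_pi_norm (fun i => xh i - x) (net.est ι)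
    have h2 := norm_add_le x (xh (net.est ι) - x)
    rw [add_sub_cancel] at h2
    linarith
  · rw [norm_smul, Real.norm_of_nonneg (hβ ι)]
    exact mul_le_of_le_one_right (hβ ι) (norm_boundaryLayer_le hε (hβ ι) _)

/-- The unit-vector term is aligned with the sliding variable of the estimate, not of the state. Up
to `ε`, it opposes the matched disturbance `w * vbar` there; the mismatch is of order `‖e‖` and
leaves the terms `β ‖e‖` and `vbar ‖e‖`. -/
theorem ControllerDesign.Lyapunov.exists_plant_estimate {c : ControllerDesign net}
    (hc : c.Lyapunov) (hnet : net.WellPosed) (hm : net.Matched) :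
    ∃ q c₁ b w : ℝ, 0 < q ∧ 0 < c₁ ∧ 0 < b ∧ 0 < w ∧
    ∀ (ε vbar : ℝ) (β : Fin net.Nc → ℝ) (x : Vec net.n) (xh : Fin net.N → Vec net.n)
      (v : Vec net.mv), 0 < ε → (∀ ι, 0 ≤ β ι) → ‖v‖ ≤ vbar →
      2 * inner ℝ (c.P ⊡ x) (net.A ⊡ x + (∑ ι, net.Bc ι ⊡ c.feedback ε β xh ι) + net.Bv ⊡ v)
        ≤ -q * ‖x‖ ^ 2 + c₁ * (‖x‖ * ‖fun i => xh i - x‖)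
          + ∑ ι, (2 * ε - 2 * (β ι - w * vbar) * ‖(net.Bc ι)ᵀ ⊡ c.P ⊡ xh (net.est ι)‖
            + 2 * b * β ι * ‖fun i => xh i - x‖ + 2 * b * (w * vbar) * ‖fun i => xh i - x‖) := by
  obtain ⟨hP, hQ⟩ := hc
  obtain ⟨q, hq, hq'⟩ := hQ.exists_lower_bound
  obtain ⟨w, hw, hw'⟩ := hnet.exists_matched hm
  obtain ⟨b, hb, hb'⟩ := exists_uniform_bound (p := fun ι b => ∀ x : Vec net.n,
    ‖(net.Bc ι)ᵀ ⊡ c.P ⊡ x‖ ≤ b * ‖x‖)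
    (fun i a b hab h x => (h x).trans (mul_le_mul_of_nonneg_right hab (norm_nonneg _)))
    (fun ι => by
      obtain ⟨b, -, h⟩ := exists_norm_toEuclideanLin_le ((net.Bc ι)ᵀ * c.P)
      exact ⟨b, fun x => by rw [← mul_toEuclideanLin]; exact h x⟩)
  obtain ⟨d, hd, hd'⟩ := exists_uniform_bound (p := fun ι b => ∀ x : Vec net.n,
    ‖c.P ⊡ net.Bc ι ⊡ c.K ι ⊡ x‖ ≤ b * ‖x‖)
    (fun i a b hab h x => (h x).trans (mul_le_mul_of_nonneg_right hab (norm_nonneg _)))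
    (fun ι => by
      obtain ⟨b, -, h⟩ := exists_norm_toEuclideanLin_le (c.P * net.Bc ι * c.K ι)
      exact ⟨b, fun x => by rw [← mul_toEuclideanLin, ← mul_toEuclideanLin]; exact h x⟩)
  have hPT : c.Pᵀ = c.P := by
    rw [← Matrix.conjTranspose_eq_transpose_of_trivial]
    exact hP.isHermitian
  have hPs : ∀ x y : Vec net.n, inner ℝ (c.P ⊡ x) y = inner ℝ x (c.P ⊡ y) := fun x y => by
    rw [inner_toEuclideanLin_left, hPT]
  -- The `+ 1` keeps the constant positive when there are no controller nodes.
  refine ⟨q, 2 * d * net.Nc + 1, b, w, hq, by positivity, hb, hw,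
    fun ε vbar β x xh v hε hβ hv => ?_⟩
  set Y := ‖fun i => xh i - x‖ with hY
  have hYi : ∀ i, ‖xh i - x‖ ≤ Y := fun i => norm_le_pi_norm (fun i => xh i - x) i
  have hYnn : 0 ≤ Y := norm_nonneg _
  obtain ⟨z, hz, hz'⟩ := hw' v
  have hzn : ∀ ι, ‖z ι‖ ≤ w * vbar := fun ι => (hz' ι).trans (by gcongr)
  have hnom : 2 * inner ℝ (c.P ⊡ x) ((net.A + ∑ ι, net.Bc ι * c.K ι) ⊡ x) ≤ -q * ‖x‖ ^ 2 := by
    have h1 := hq' x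
    rw [map_neg, LinearMap.neg_apply, inner_neg_right, add_toEuclideanLin, inner_add_right,
      mul_toEuclideanLin, mul_toEuclideanLin, ← inner_toEuclideanLin_left,
      real_inner_comm, ← hPs] at h1
    linarith
  -- Nominal state feedback plus, in each channel, the estimation error in `K^ι` and the disturbance
  -- minus the unit-vector term.
  have hsplit : net.A ⊡ x + (∑ ι, net.Bc ι ⊡ c.feedback ε β xh ι) + net.Bv ⊡ v
      = (net.A + ∑ ι, net.Bc ι * c.K ι) ⊡ x + ∑ ι, (net.Bc ι ⊡ c.K ι ⊡ (xh (net.est ι) - x)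
        + net.Bc ι ⊡ (z ι - β ι • boundaryLayer ε (β ι)
            ((net.Bc ι)ᵀ ⊡ c.P ⊡ xh (net.est ι)))) := by
    rw [hz, add_toEuclideanLin, map_sum, LinearMap.sum_apply, add_assoc, add_assoc,
      ← Finset.sum_add_distrib, ← Finset.sum_add_distrib]
    congr 1
    refine Finset.sum_congr rfl fun ι _ => ?_
    rw [mul_toEuclideanLin, ControllerDesign.feedback]
    simp only [map_sub]
    abel
  rw [hsplit, inner_add_right, mul_add, inner_sum]
  have hterm : ∀ ι, 2 * inner ℝ (c.P ⊡ x) (net.Bc ι ⊡ c.K ι ⊡ (xh (net.est ι) - x)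
        + net.Bc ι ⊡ (z ι - β ι • boundaryLayer ε (β ι)
            ((net.Bc ι)ᵀ ⊡ c.P ⊡ xh (net.est ι))))
      ≤ 2 * d * (‖x‖ * Y)
        + (2 * ε - 2 * (β ι - w * vbar) * ‖(net.Bc ι)ᵀ ⊡ c.P ⊡ xh (net.est ι)‖
            + 2 * b * β ι * Y + 2 * b * (w * vbar) * Y) := by
    intro ι
    set ω := (net.Bc ι)ᵀ ⊡ c.P ⊡ xh (net.est ι) with hω
    set g := boundaryLayer ε (β ι) ω with hg
    have h1 : inner ℝ (c.P ⊡ x) (net.Bc ι ⊡ c.K ι ⊡ (xh (net.est ι) - x)) ≤ d * (‖x‖ * Y) := by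
      rw [hPs]
      refine (real_inner_le_norm _ _).trans ?_
      have := (hd' ι (xh (net.est ι) - x)).trans (mul_le_mul_of_nonneg_left (hYi _) hd.le)
      calc _ ≤ ‖x‖ * (d * Y) := by gcongr
        _ = _ := by ring
    have h2 : (net.Bc ι)ᵀ ⊡ c.P ⊡ x = ω - (net.Bc ι)ᵀ ⊡ c.P ⊡ (xh (net.est ι) - x) := by
      simp only [hω, map_sub]
      abel
    set η := (net.Bc ι)ᵀ ⊡ c.P ⊡ (xh (net.est ι) - x) with hη
    have hηn : ‖η‖ ≤ b * Y := (hb' ι _).trans (mul_le_mul_of_nonneg_left (hYi _) hb.le)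
    have hgn : ‖g‖ ≤ 1 := norm_boundaryLayer_le hε (hβ ι) ω
    have h3 := le_mul_inner_boundaryLayer hε (hβ ι) ω
    rw [← hg] at h3
    have h4 : inner ℝ ω (z ι) ≤ w * vbar * ‖ω‖ := by
      refine (real_inner_le_norm _ _).trans ?_
      rw [mul_comm]
      gcongr
      exact hzn ι
    have h5 : -inner ℝ η (z ι) ≤ b * (w * vbar) * Y := by
      rw [← inner_neg_left]
      refine (real_inner_le_norm _ _).trans ?_
      rw [norm_neg]
      calc _ ≤ (b * Y) * (w * vbar) := mul_le_mul hηn (hzn ι) (norm_nonneg _) (by positivity)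
        _ = _ := by ring
    have h6 : inner ℝ η g ≤ b * Y := by
      refine (real_inner_le_norm _ _).trans ?_
      calc _ ≤ (b * Y) * 1 := mul_le_mul hηn hgn (norm_nonneg _) (by positivity)
        _ = _ := by ring
    have h7 := mul_le_mul_of_nonneg_left h6 (hβ ι)
    rw [inner_add_right, inner_toEuclideanLin_right (net.Bc ι) _ (z ι - β ι • g), h2,
      inner_sub_left, inner_sub_right, inner_sub_right, inner_smul_right, inner_smul_right]
    linarith
  have hsum := Finset.sum_le_sum fun ι (_ : ι ∈ Finset.univ) => hterm ι
  rw [← Finset.mul_sum, Finset.sum_add_distrib, Finset.sum_const, Finset.card_univ,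
    Fintype.card_fin, nsmul_eq_mul] at hsum
  have hxy : 0 ≤ ‖x‖ * Y := by positivity
  linarith

/-- The left side is the derivative of the energy. Along `T_id` it sees only `E_i`; along `T_iu` the
coupling terms produce exactly the damping in `γ_i` and `γ_is`, and the remaining inputs are
bounded. -/
theorem ObserverDesign.Admissible.exists_observer_estimate {D : ObserverDesign net}
    (hA : D.Admissible) (c : ControllerDesign net) :
    ∃ c₂ c₃ : ℝ, 0 < c₂ ∧ 0 < c₃ ∧
    ∀ (ε vbar : ℝ) (β : Fin net.Nc → ℝ) (γ γs : Fin net.N → ℝ) (x : Vec net.n)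
      (xh : Fin net.N → Vec net.n) (v : Vec net.mv) (e e' : Fin net.N → Vec net.n),
      0 < ε → (∀ ι, 0 ≤ β ι) → ‖v‖ ≤ vbar → (e = fun i => xh i - x) →
      (∀ i, (D.Td i)ᵀ ⊡ e' i = D.E i ⊡ (D.Td i)ᵀ ⊡ e i) →
      (∀ i, ∃ w ∈ unitSet ((D.Tu i)ᵀ ⊡ net.lap e i), (D.Tu i)ᵀ ⊡ e' i
        = (D.Tu i)ᵀ ⊡ (net.A ⊡ e i - net.hiddenInput (c.feedback ε β xh) v i)
          - γ i • (D.Tu i)ᵀ ⊡ net.lap e i - γs i • w) →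
      ∑ i, inner ℝ (net.lap e i) (e' i) ≤ c₂ * ((‖x‖ + ‖e‖ + ∑ ι, β ι) * ‖e‖)
        + ∑ i, (c₃ * vbar * ‖(D.Tu i)ᵀ ⊡ net.lap e i‖ - γ i * ‖(D.Tu i)ᵀ ⊡ net.lap e i‖ ^ 2
          - γs i * ‖(D.Tu i)ᵀ ⊡ net.lap e i‖) := by
  have hm : ∀ {ι : Type} (n' m' : ι → ℕ) (f : ∀ i, Vec (n' i) → Vec (m' i)) i (a b : ℝ), a ≤ b →
      (∀ x, ‖f i x‖ ≤ a * ‖x‖) → ∀ x, ‖f i x‖ ≤ b * ‖x‖ := fun n' m' f i a b hab h x =>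
    (h x).trans (mul_le_mul_of_nonneg_right hab (norm_nonneg _))
  have hbd : ∀ (n' m' : Fin net.N → ℕ) (M : ∀ i, Matrix (Fin (m' i)) (Fin (n' i)) ℝ),
      ∃ b, 0 < b ∧ ∀ i (x : Vec (n' i)), ‖M i ⊡ x‖ ≤ b * ‖x‖ := fun n' m' M =>
    exists_uniform_bound (hm n' m' fun i x => M i ⊡ x) fun i => by
      obtain ⟨b, -, h⟩ := exists_norm_toEuclideanLin_le (M i)
      exact ⟨b, h⟩
  obtain ⟨l, hl, hl'⟩ := net.exists_norm_lap_le
  obtain ⟨f, hf, hf'⟩ := c.exists_norm_feedback_le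
  obtain ⟨g, hg, hg'⟩ := net.exists_norm_hiddenInput_le
  obtain ⟨t, ht, ht'⟩ := hbd _ _ fun i => (D.Tu i)ᵀ
  obtain ⟨s, hs, hs'⟩ := hbd _ _ fun i => (D.Td i)ᵀ
  obtain ⟨r, hr, hr'⟩ := hbd _ _ D.E
  obtain ⟨a, ha, ha'⟩ := exists_norm_toEuclideanLin_le net.A
  -- `k₁` bounds the drift through `E_i` and `A`, `k₂` the part of the hidden input due to feedback.
  set k₁ := s * l * (r * s) + t * l * (t * a) with hk₁
  set k₂ := t * l * t * g * (net.Nc * f + 1) with hk₂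
  refine ⟨net.N * (k₁ + k₂) + 1, t * g, by positivity, by positivity, ?_⟩
  intro ε vbar β γ γs x xh v e e' hε hβ hv he hd hu
  have hen : ∀ i, ‖e i‖ ≤ ‖e‖ := norm_le_pi_norm e
  have hβs : 0 ≤ ∑ ι, β ι := Finset.sum_nonneg fun ι _ => hβ ι
  have hin : ∀ i, ‖net.hiddenInput (c.feedback ε β xh) v i‖
      ≤ g * (net.Nc * f + 1) * (‖x‖ + ‖e‖ + ∑ ι, β ι) + g * vbar := by
    intro i
    refine (hg' i _ v).trans ?_
    have h1 : ∑ ι, ‖c.feedback ε β xh ι‖ ≤ ∑ ι, (f * (‖x‖ + ‖e‖) + β ι) :=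
      Finset.sum_le_sum fun ι _ => by
        rw [he]
        exact hf' ε β x xh hε hβ ι
    rw [Finset.sum_add_distrib, Finset.sum_const, Finset.card_univ, Fintype.card_fin,
      nsmul_eq_mul] at h1
    have h2 : 0 ≤ (net.Nc : ℝ) * f * ∑ ι, β ι := by positivity
    have h3 : (0 : ℝ) ≤ ‖x‖ + ‖e‖ := by positivity
    calc _ ≤ g * (net.Nc * (f * (‖x‖ + ‖e‖)) + ∑ ι, β ι + vbar) := by gcongr
      _ ≤ g * ((net.Nc * f + 1) * (‖x‖ + ‖e‖ + ∑ ι, β ι) + vbar) := by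
        gcongr
        linarith
      _ = _ := by ring
  have hterm : ∀ i, inner ℝ (net.lap e i) (e' i)
      ≤ (k₁ + k₂) * ((‖x‖ + ‖e‖ + ∑ ι, β ι) * ‖e‖)
        + (t * g * vbar * ‖(D.Tu i)ᵀ ⊡ net.lap e i‖ - γ i * ‖(D.Tu i)ᵀ ⊡ net.lap e i‖ ^ 2
          - γs i * ‖(D.Tu i)ᵀ ⊡ net.lap e i‖) := by
    intro i
    obtain ⟨w, hw, hw'⟩ := hu i
    rw [hA.inner_split i, hd i, hw', inner_sub_right, inner_sub_right, inner_smul_right,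
      inner_smul_right, real_inner_self_eq_norm_sq, inner_eq_norm_of_mem_unitSet hw,
      map_sub, inner_sub_right]
    have hlap := hl' e i
    have hεn : ‖(D.Tu i)ᵀ ⊡ net.lap e i‖ ≤ t * (l * ‖e‖) := (ht' i _).trans (by gcongr)
    have h1 : inner ℝ ((D.Td i)ᵀ ⊡ net.lap e i) (D.E i ⊡ (D.Td i)ᵀ ⊡ e i)
        ≤ s * l * (r * s) * (‖e‖ * ‖e‖) := by
      refine (real_inner_le_norm _ _).trans ?_
      calc _ ≤ (s * (l * ‖e‖)) * (r * (s * ‖e‖)) := by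
            gcongr
            · exact (hs' i _).trans (by gcongr)
            · exact (hr' i _).trans (by gcongr; exact (hs' i _).trans (by gcongr; exact hen i))
        _ = _ := by ring
    have h2 : inner ℝ ((D.Tu i)ᵀ ⊡ net.lap e i) ((D.Tu i)ᵀ ⊡ net.A ⊡ e i)
        ≤ t * l * (t * a) * (‖e‖ * ‖e‖) := by
      refine (real_inner_le_norm _ _).trans ?_
      calc _ ≤ (t * (l * ‖e‖)) * (t * (a * ‖e‖)) := by
            gcongr
            exact (ht' i _).trans (by gcongr; exact (ha' _).trans (by gcongr; exact hen i))
        _ = _ := by ring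
    -- The `vbar` part keeps its factor `‖ε_iu‖`, so that `γ_is` can dominate it; in the other part
    -- `‖ε_iu‖` is bounded by a multiple of `‖e‖`.
    have h3 : -inner ℝ ((D.Tu i)ᵀ ⊡ net.lap e i)
          ((D.Tu i)ᵀ ⊡ net.hiddenInput (c.feedback ε β xh) v i)
        ≤ k₂ * ((‖x‖ + ‖e‖ + ∑ ι, β ι) * ‖e‖)
          + t * g * vbar * ‖(D.Tu i)ᵀ ⊡ net.lap e i‖ := by
      rw [← inner_neg_left]
      refine (real_inner_le_norm _ _).trans ?_
      rw [norm_neg]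
      calc _ ≤ ‖(D.Tu i)ᵀ ⊡ net.lap e i‖ * (t * (g * (net.Nc * f + 1)
              * (‖x‖ + ‖e‖ + ∑ ι, β ι) + g * vbar)) := by
            gcongr
            exact (ht' i _).trans (by gcongr; exact hin i)
        _ = ‖(D.Tu i)ᵀ ⊡ net.lap e i‖ * (t * (g * (net.Nc * f + 1)
              * (‖x‖ + ‖e‖ + ∑ ι, β ι))) + t * g * vbar * ‖(D.Tu i)ᵀ ⊡ net.lap e i‖ := by ring
        _ ≤ (t * (l * ‖e‖)) * (t * (g * (net.Nc * f + 1)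
              * (‖x‖ + ‖e‖ + ∑ ι, β ι))) + t * g * vbar * ‖(D.Tu i)ᵀ ⊡ net.lap e i‖ := by gcongr
        _ = _ := by rw [hk₂]; ring
    have h4 : k₁ * (‖e‖ * ‖e‖) ≤ k₁ * ((‖x‖ + ‖e‖ + ∑ ι, β ι) * ‖e‖) := by
      gcongr
      linarith [norm_nonneg x]
    linarith
  have hsum := Finset.sum_le_sum fun i (_ : i ∈ Finset.univ) => hterm i
  rw [Finset.sum_add_distrib, Finset.sum_const, Finset.card_univ,
    Fintype.card_fin, nsmul_eq_mul] at hsum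
  have hxy : 0 ≤ (‖x‖ + ‖e‖ + ∑ ι, β ι) * ‖e‖ := by positivity
  linarith

end

/-! ### The Lyapunov function and its dissipation inequality -/

section

variable {net : ControlNetwork}

/-- The parameters of the Lyapunov function: the matrices `Q_i` and the weight `k` of the decoupled
error components, and the reference values of the adaptive gains. -/
structure LyapunovWeights (D : ObserverDesign net) where
  Q : ∀ i, Matrix (Fin (D.δ i)) (Fin (D.δ i)) ℝ
  k : ℝ
  β : ℝ
  γ : ℝ
  γs : ℝ

namespace LyapunovWeights

variable {D : ObserverDesign net}

/-- The part of the Lyapunov function which depends on the plant state and the errors. -/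
def stateValue (w : LyapunovWeights D) (P : Matrix (Fin net.n) (Fin net.n) ℝ) (x : Vec net.n)
    (e : Fin net.N → Vec net.n) : ℝ :=
  inner ℝ x (P ⊡ x) + net.energy e
    + w.k * ∑ i, inner ℝ ((D.Td i)ᵀ ⊡ e i) (w.Q i ⊡ (D.Td i)ᵀ ⊡ e i)

/-- The part of the Lyapunov function which depends on the adaptive gains. -/
def gainValue (w : LyapunovWeights D) (φ : Tuning net) (β : Fin net.Nc → ℝ)
    (γ γs : Fin net.N → ℝ) : ℝ :=
  ∑ ι, (β ι - w.β) ^ 2 / φ.β ι + ∑ i, (γ i - w.γ) ^ 2 / (2 * φ.γ i)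
    + ∑ i, (γs i - w.γs) ^ 2 / (2 * φ.γs i)

/-- The constant term of the dissipation inequality. -/
def residual (w : LyapunovWeights D) (σ : Leakage net) (φ : Tuning net) : ℝ :=
  ∑ ι, (2 * φ.ε + 2 * (σ.β ι / φ.β ι) * w.β ^ 2)
    + ∑ i, σ.γ i / (2 * φ.γ i) * w.γ ^ 2 + ∑ i, σ.γs i / (2 * φ.γs i) * w.γs ^ 2

end LyapunovWeights

/-- The adaptation law cancels `2 (β - b₀) s` exactly. The leakage contributes `-(σ / φ) ((β - b₀)²
+ β² - b₀²)`, and its `β²` pays for the products `β Y` by Young's inequality. -/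
theorem control_gain_dissipation {ε β b₀ s b c Y σ φ : ℝ} (hσ : 0 < σ) (hφ : 0 < φ) :
    2 * ε - 2 * (β - b₀) * s + 2 * b * β * Y + 2 * b * b₀ * Y + c * β * Y
      + 2 * (β - b₀) * (-σ * β + φ * s) / φ
    ≤ 2 * ε + 2 * (σ / φ) * b₀ ^ 2 - σ / φ * (β - b₀) ^ 2
      + ((2 * b + c) ^ 2 + b ^ 2) * (φ / σ) * Y ^ 2 := by
  have ha : 0 < σ / φ := by positivity
  set a := σ / φ with ha'
  have h1 : 2 * (β - b₀) * (-σ * β + φ * s) / φ = 2 * (β - b₀) * s - 2 * (β - b₀) * β * a := by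
    rw [ha']; field_simp; ring
  have h2 : φ / σ = a⁻¹ := by rw [ha', inv_div]
  rw [h1, h2]
  have h3 : (2 * b + c) * β * Y ≤ a * β ^ 2 + (2 * b + c) ^ 2 * a⁻¹ * Y ^ 2 := by
    have h := sq_nonneg (β - (2 * b + c) / 2 * a⁻¹ * Y)
    have h' := mul_nonneg ha.le h
    have : a * (β - (2 * b + c) / 2 * a⁻¹ * Y) ^ 2
        = a * β ^ 2 - (2 * b + c) * β * Y + (2 * b + c) ^ 2 * a⁻¹ * Y ^ 2 / 4 := by
      field_simp; ring
    have hp : 0 ≤ (2 * b + c) ^ 2 * a⁻¹ * Y ^ 2 := by positivity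
    linarith
  have h4 : 2 * b * b₀ * Y ≤ a * b₀ ^ 2 + b ^ 2 * a⁻¹ * Y ^ 2 := by
    have h := sq_nonneg (b₀ - b * a⁻¹ * Y)
    have h' := mul_nonneg ha.le h
    have : a * (b₀ - b * a⁻¹ * Y) ^ 2
        = a * b₀ ^ 2 - 2 * b * b₀ * Y + b ^ 2 * a⁻¹ * Y ^ 2 := by
      field_simp; ring
    linarith
  nlinarith

/-- Adaptation replaces the actual gain by the reference `γ₀`; completing the square in the leakage
gives decay towards `γ₀` and a constant. -/
theorem observer_gain_dissipation {γ γ₀ y σ φ : ℝ} (hσ : 0 < σ) (hφ : 0 < φ) :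
    -γ * y + (γ - γ₀) * (-σ * γ + φ * y) / φ
      ≤ -γ₀ * y - σ / (2 * φ) * (γ - γ₀) ^ 2 + σ / (2 * φ) * γ₀ ^ 2 := by
  have h1 : (γ - γ₀) * (-σ * γ + φ * y) / φ = (γ - γ₀) * y - σ / (2 * φ) * (2 * (γ - γ₀) * γ) := by
    field_simp; ring
  have ha : 0 < σ / (2 * φ) := by positivity
  rw [h1]
  nlinarith [mul_nonneg ha.le (sq_nonneg γ)]

theorem plant_dissipation {q c₁ c₂ X Y : ℝ} (hq : 0 < q) :
    -q * X ^ 2 + c₁ * (X * Y) + c₂ * ((X + Y) * Y)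
      ≤ -(q / 2) * X ^ 2 + (c₂ + (c₁ + c₂) ^ 2 / (2 * q)) * Y ^ 2 := by
  have h := mul_nonneg hq.le (sq_nonneg (X - (c₁ + c₂) / q * Y))
  have : q * (X - (c₁ + c₂) / q * Y) ^ 2
      = q * X ^ 2 - 2 * (c₁ + c₂) * (X * Y) + (c₁ + c₂) ^ 2 / q * Y ^ 2 := by field_simp; ring
  have h2 : (c₁ + c₂) ^ 2 / (2 * q) = (c₁ + c₂) ^ 2 / q / 2 := by field_simp
  rw [h2]
  linarith

/-- For a static observer `E_i = 0` gives no decay, but then the premise forces `d = 0`, so `Q_i =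
1` will do. -/
theorem ObserverDesign.Admissible.exists_decoupled_lyapunov {D : ObserverDesign net}
    (hA : D.Admissible) :
    ∃ Q : ∀ i, Matrix (Fin (D.δ i)) (Fin (D.δ i)) ℝ, ∃ a b : ℝ, 0 < a ∧ 0 < b ∧
      (∀ i, (Q i)ᵀ = Q i) ∧
      (∀ i (d : Vec (D.δ i)), a * ‖d‖ ^ 2 ≤ inner ℝ d (Q i ⊡ d)) ∧
      (∀ i (d : Vec (D.δ i)), inner ℝ d (Q i ⊡ d) ≤ b * ‖d‖ ^ 2) ∧
      ∀ i (d : Vec (D.δ i)), (D.E i = 0 → D.F i = 0 → D.G i * net.C i = (D.Td i)ᵀ → d = 0) →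
        2 * inner ℝ (Q i ⊡ d) (D.E i ⊡ d) ≤ -‖d‖ ^ 2 := by
  have h : ∀ i, ∃ Q : Matrix (Fin (D.δ i)) (Fin (D.δ i)) ℝ, Qᵀ = Q ∧ (∃ c, 0 < c ∧
      ∀ d : Vec (D.δ i), c * ‖d‖ ^ 2 ≤ inner ℝ d (Q ⊡ d)) ∧ ∀ d : Vec (D.δ i),
      (D.E i = 0 → D.F i = 0 → D.G i * net.C i = (D.Td i)ᵀ → d = 0) →
        2 * inner ℝ (Q ⊡ d) (D.E i ⊡ d) ≤ -‖d‖ ^ 2 := fun i => by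
    rcases hA.stable i with hs | ⟨h1, h2, h3⟩
    · obtain ⟨Q, hQ, hpos, hneg⟩ := hs.exists_lyapunov
      exact ⟨Q, hQ, hpos, fun d _ => hneg d⟩
    · refine ⟨1, Matrix.transpose_one, ⟨1, one_pos, fun d => ?_⟩, fun d hd => ?_⟩
      · rw [one_toEuclideanLin, real_inner_self_eq_norm_sq, one_mul]
      · simp [hd h1 h2 h3]
  choose Q hQ hpos hneg using h
  obtain ⟨a, ha, ha'⟩ := exists_uniform_lower_bound (p := fun i a => ∀ d : Vec (D.δ i),
    a * ‖d‖ ^ 2 ≤ inner ℝ d (Q i ⊡ d))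
    (fun i a b hab h d => (mul_le_mul_of_nonneg_right hab (by positivity)).trans (h d)) hpos
  obtain ⟨b, hb, hb'⟩ := exists_uniform_bound (p := fun i a => ∀ d : Vec (D.δ i),
    inner ℝ d (Q i ⊡ d) ≤ a * ‖d‖ ^ 2)
    (fun i a b hab h d => (h d).trans (mul_le_mul_of_nonneg_right hab (by positivity)))
    (fun i => by
      obtain ⟨b, -, h⟩ := exists_inner_toEuclideanLin_le (Q i)
      exact ⟨b, h⟩)
  exact ⟨Q, a, b, ha, hb, hQ, ha', hb', hneg⟩

-- The sliding terms cancel against the gain dynamics, so what remains to dominate is a multiple of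
-- `‖e‖²`. This is done by `-(k / 2) ∑ ‖ε_iu‖²`, coming from the reference `k / 2` of `γ_i`, and
-- half of `-k ∑ ‖d_i‖²`. The references for `β^ι` and `γ_is` are the disturbance bounds.
set_option maxHeartbeats 1000000 in
theorem exists_dissipation {D : ObserverDesign net} {c : ControllerDesign net}
    {σ : Leakage net} (hnet : net.WellPosed) (hA : D.Admissible) (hm : net.Matched)
    (hg : net.ConnectedGraph) (hdet : D.CollectivelyDetectable) (hc : c.Lyapunov) (hσ : σ.Pos) :
    ∃ (Q : ∀ i, Matrix (Fin (D.δ i)) (Fin (D.δ i)) ℝ) (ρ a b₀ s₀ : ℝ)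
      (k : (Fin net.Nc → ℝ) → ℝ), 0 < ρ ∧ 0 < a ∧ (∀ i, (Q i)ᵀ = Q i) ∧
      ∀ (φ : Tuning net), φ.Pos → ∀ vbar : ℝ,
      ∀ w : LyapunovWeights D, w = ⟨Q, k φ.β, b₀ * vbar, k φ.β / 2, s₀ * vbar⟩ →
      (∀ x e, a * (‖x‖ ^ 2 + ‖e‖ ^ 2) ≤ w.stateValue c.P x e) ∧
      ∀ (β : Fin net.Nc → ℝ) (γ γs : Fin net.N → ℝ) (x : Vec net.n)
      (xh : Fin net.N → Vec net.n) (v : Vec net.mv) (e e' : Fin net.N → Vec net.n),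
      (∀ ι, 0 ≤ β ι) → ‖v‖ ≤ vbar → (e = fun i => xh i - x) →
      (∀ i, (D.Td i)ᵀ ⊡ e' i = D.E i ⊡ (D.Td i)ᵀ ⊡ e i) →
      (∀ i, D.E i = 0 → D.F i = 0 → D.G i * net.C i = (D.Td i)ᵀ → (D.Td i)ᵀ ⊡ e i = 0) →
      (∀ i, ∃ h ∈ unitSet ((D.Tu i)ᵀ ⊡ net.lap e i), (D.Tu i)ᵀ ⊡ e' i
        = (D.Tu i)ᵀ ⊡ (net.A ⊡ e i - net.hiddenInput (c.feedback φ.ε β xh) v i)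
          - γ i • (D.Tu i)ᵀ ⊡ net.lap e i - γs i • h) →
      (2 * inner ℝ (c.P ⊡ x)
          (net.A ⊡ x + (∑ ι, net.Bc ι ⊡ c.feedback φ.ε β xh ι) + net.Bv ⊡ v)
        + ∑ i, inner ℝ (net.lap e i) (e' i)
        + w.k * ∑ i, 2 * inner ℝ (w.Q i ⊡ (D.Td i)ᵀ ⊡ e i) ((D.Td i)ᵀ ⊡ e' i))
        + (∑ ι, 2 * (β ι - w.β) * (-σ.β ι * β ι
            + φ.β ι * ‖(net.Bc ι)ᵀ ⊡ c.P ⊡ xh (net.est ι)‖) / φ.β ι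
          + ∑ i, (γ i - w.γ) * (-σ.γ i * γ i
            + φ.γ i * ‖(D.Tu i)ᵀ ⊡ net.lap e i‖ ^ 2) / φ.γ i
          + ∑ i, (γs i - w.γs) * (-σ.γs i * γs i
            + φ.γs i * ‖(D.Tu i)ᵀ ⊡ net.lap e i‖) / φ.γs i)
      ≤ -ρ * (w.stateValue c.P x e + w.gainValue φ β γ γs) + w.residual σ φ := by
  obtain ⟨q, c₁, b, b₀, hq, hc₁, hb, hb₀, hplant⟩ := hc.exists_plant_estimate hnet hm
  obtain ⟨c₂, s₀, hc₂, hs₀, hobs⟩ := hA.exists_observer_estimate c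
  obtain ⟨Q, qa, qb, hqa, hqb, hQ, hQa, hQb, hQE⟩ := hA.exists_decoupled_lyapunov
  obtain ⟨κ, hκ, hκ'⟩ := hg.exists_norm_sq_le hA hdet
  obtain ⟨m, hm0, hm'⟩ := hg.exists_energy_add_lower_bound hdet
  obtain ⟨cE, hcE, hcE'⟩ := net.exists_energy_le
  obtain ⟨pa, hpa, hpa'⟩ := hc.1.exists_lower_bound
  obtain ⟨pb, hpb, hpb'⟩ := exists_inner_toEuclideanLin_le c.P
  obtain ⟨hσβ, hσγ, hσγs⟩ := hσ
  obtain ⟨ρ₁, hρ₁, hρ₁'⟩ := exists_uniform_lower_bound (p := fun ι a => a ≤ σ.β ι)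
    (fun _ _ _ => le_trans) fun ι => ⟨_, hσβ ι, le_rfl⟩
  obtain ⟨ρ₂, hρ₂, hρ₂'⟩ := exists_uniform_lower_bound (p := fun i a => a ≤ σ.γ i)
    (fun _ _ _ => le_trans) fun i => ⟨_, hσγ i, le_rfl⟩
  obtain ⟨ρ₃, hρ₃, hρ₃'⟩ := exists_uniform_lower_bound (p := fun i a => a ≤ σ.γs i)
    (fun _ _ _ => le_trans) fun i => ⟨_, hσγs i, le_rfl⟩
  -- The total coefficient of `‖e‖²` after all applications of Young's inequality; the only tuning
  -- it involves is `φ^ι`.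
  set H : (Fin net.Nc → ℝ) → ℝ := fun φ => c₂ + (c₁ + c₂) ^ 2 / (2 * q)
    + ∑ ι, ((2 * b + c₂) ^ 2 + b ^ 2) * (φ ι / σ.β ι) with hH
  -- No tuning parameter constrains `ρ`: the `d_i` terms of `V` and their decay both scale with `k`,
  -- the gain terms and their leakage both with the inverse step sizes.
  have hρ : ∃ ρ, 0 < ρ ∧ ρ ≤ 1 ∧ ρ ≤ ρ₁ ∧ ρ ≤ ρ₂ ∧ ρ ≤ ρ₃ ∧ ρ * pb ≤ q / 2 ∧ ρ * qb ≤ 1 / 2 := by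
    refine ⟨min (min (min 1 ρ₁) (min ρ₂ ρ₃)) (min (q / 2 / pb) (1 / 2 / qb)), by positivity,
      ?_, ?_, ?_, ?_, ?_, ?_⟩
    · simp
    · simp
    · simp
    · simp
    · rw [← le_div_iff₀ hpb]; simp
    · rw [← le_div_iff₀ hqb]; simp
  obtain ⟨ρ, hρ, hρone, hρβ, hργ, hργs, hρp, hρq⟩ := hρ
  -- With this `k`, `k / 2` exceeds `κ (H + cE)`, where `cE` pays for the decay of the energy. The
  -- `+ 1` gives `k ≥ 1`, so the coercivity constant need not depend on `k`.
  refine ⟨Q, ρ, min pa (min 1 qa * m), b₀, s₀, fun φ => 2 * (κ * (H φ + cE)) + 1, hρ,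
    by positivity, hQ, fun φ hφ vbar w hw => ?_⟩
  obtain ⟨hφε, hφβ, hφγ, hφγs⟩ := hφ
  have hHφ : 0 ≤ H φ.β := by
    have : 0 ≤ ∑ ι, ((2 * b + c₂) ^ 2 + b ^ 2) * (φ.β ι / σ.β ι) :=
      Finset.sum_nonneg fun ι _ => by
        have := hφβ ι
        have := hσβ ι
        positivity
    simp only [hH]
    positivity
  have hwk : w.k = 2 * (κ * (H φ.β + cE)) + 1 := by rw [hw]
  have hwQ : w.Q = Q := by rw [hw]
  have hwβ : w.β = b₀ * vbar := by rw [hw]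
  have hwγ : w.γ = w.k / 2 := by rw [hw]
  have hwγs : w.γs = s₀ * vbar := by rw [hw]
  have hk1 : 1 ≤ w.k := by
    rw [hwk]
    have : 0 ≤ κ * (H φ.β + cE) := by positivity
    linarith
  have hDnn : ∀ e : Fin net.N → Vec net.n, 0 ≤ ∑ i, ‖(D.Td i)ᵀ ⊡ e i‖ ^ 2 := fun e =>
    Finset.sum_nonneg fun i _ => by positivity
  have hDQa : ∀ e : Fin net.N → Vec net.n, qa * ∑ i, ‖(D.Td i)ᵀ ⊡ e i‖ ^ 2
      ≤ ∑ i, inner ℝ ((D.Td i)ᵀ ⊡ e i) (w.Q i ⊡ (D.Td i)ᵀ ⊡ e i) := fun e => by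
    rw [Finset.mul_sum, hwQ]
    exact Finset.sum_le_sum fun i _ => hQa i _
  have hDQb : ∀ e : Fin net.N → Vec net.n,
      ∑ i, inner ℝ ((D.Td i)ᵀ ⊡ e i) (w.Q i ⊡ (D.Td i)ᵀ ⊡ e i)
        ≤ qb * ∑ i, ‖(D.Td i)ᵀ ⊡ e i‖ ^ 2 := fun e => by
    rw [Finset.mul_sum, hwQ]
    exact Finset.sum_le_sum fun i _ => hQb i _
  refine ⟨fun x e => ?_, ?_⟩
  · have h1 := hpa' x
    have h2 := hm' e
    have h3 := hDQa e
    have h4 := hDnn e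
    have h5 := hg.energy_nonneg e
    have h6 : min 1 qa * (m * ‖e‖ ^ 2) ≤ net.energy e
        + w.k * ∑ i, inner ℝ ((D.Td i)ᵀ ⊡ e i) (w.Q i ⊡ (D.Td i)ᵀ ⊡ e i) := by
      calc _ ≤ min 1 qa * (net.energy e + ∑ i, ‖(D.Td i)ᵀ ⊡ e i‖ ^ 2) := by gcongr
        _ = min 1 qa * net.energy e + min 1 qa * ∑ i, ‖(D.Td i)ᵀ ⊡ e i‖ ^ 2 := by ring
        _ ≤ 1 * net.energy e + qa * ∑ i, ‖(D.Td i)ᵀ ⊡ e i‖ ^ 2 := by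
          gcongr
          · exact min_le_left _ _
          · exact min_le_right _ _
        _ ≤ _ := by
          have h7 := mul_nonneg hqa.le h4
          nlinarith
    have h7 : min pa (min 1 qa * m) * ‖x‖ ^ 2 ≤ pa * ‖x‖ ^ 2 := by
      gcongr
      exact min_le_left _ _
    have h8 : min pa (min 1 qa * m) * ‖e‖ ^ 2 ≤ min 1 qa * m * ‖e‖ ^ 2 := by
      gcongr
      exact min_le_right _ _
    unfold LyapunovWeights.stateValue
    linarith
  · intro β γ γs x xh v e e' hβ hv he hd hstatic hu
    have hp := hplant φ.ε vbar β x xh v hφε hβ hv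
    have ho := hobs φ.ε vbar β γ γs x xh v e e' hφε hβ hv he hd hu
    rw [← he, ← hwβ] at hp
    rw [← hwγs] at ho
    have hdec : ∑ i, 2 * inner ℝ (w.Q i ⊡ (D.Td i)ᵀ ⊡ e i) ((D.Td i)ᵀ ⊡ e' i)
        ≤ -∑ i, ‖(D.Td i)ᵀ ⊡ e i‖ ^ 2 := by
      rw [← Finset.sum_neg_distrib]
      refine Finset.sum_le_sum fun i _ => ?_
      rw [hd i, hwQ]
      exact hQE i _ (hstatic i)
    have hdec' := mul_le_mul_of_nonneg_left hdec (zero_le_one.trans hk1)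
    have hβsum := Finset.sum_le_sum fun ι (_ : ι ∈ Finset.univ) =>
      control_gain_dissipation (ε := φ.ε) (β := β ι) (b₀ := w.β) (b := b) (c := c₂) (Y := ‖e‖)
        (s := ‖(net.Bc ι)ᵀ ⊡ c.P ⊡ xh (net.est ι)‖) (hσβ ι) (hφβ ι)
    have hγsum := Finset.sum_le_sum fun i (_ : i ∈ Finset.univ) =>
      observer_gain_dissipation (γ := γ i) (γ₀ := w.γ) (y := ‖(D.Tu i)ᵀ ⊡ net.lap e i‖ ^ 2)
        (hσγ i) (hφγ i)
    have hγssum := Finset.sum_le_sum fun i (_ : i ∈ Finset.univ) =>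
      observer_gain_dissipation (γ := γs i) (γ₀ := w.γs) (y := ‖(D.Tu i)ᵀ ⊡ net.lap e i‖)
        (hσγs i) (hφγs i)
    have hpd := plant_dissipation (c₁ := c₁) (c₂ := c₂) (X := ‖x‖) (Y := ‖e‖) hq
    have hgβ : ρ * ∑ ι, (β ι - w.β) ^ 2 / φ.β ι
        ≤ ∑ ι, σ.β ι / φ.β ι * (β ι - w.β) ^ 2 := by
      rw [Finset.mul_sum]
      refine Finset.sum_le_sum fun ι _ => ?_
      have h1 : 0 ≤ (β ι - w.β) ^ 2 / φ.β ι := div_nonneg (sq_nonneg _) (hφβ ι).le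
      calc _ ≤ σ.β ι * ((β ι - w.β) ^ 2 / φ.β ι) := by
            gcongr
            exact hρβ.trans (hρ₁' ι)
        _ = _ := by ring
    have hgγ : ρ * ∑ i, (γ i - w.γ) ^ 2 / (2 * φ.γ i)
        ≤ ∑ i, σ.γ i / (2 * φ.γ i) * (γ i - w.γ) ^ 2 := by
      rw [Finset.mul_sum]
      refine Finset.sum_le_sum fun i _ => ?_
      have h0 := hφγ i
      have h1 : 0 ≤ (γ i - w.γ) ^ 2 / (2 * φ.γ i) := by positivity
      calc _ ≤ σ.γ i * ((γ i - w.γ) ^ 2 / (2 * φ.γ i)) := by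
            gcongr
            exact hργ.trans (hρ₂' i)
        _ = _ := by ring
    have hgγs : ρ * ∑ i, (γs i - w.γs) ^ 2 / (2 * φ.γs i)
        ≤ ∑ i, σ.γs i / (2 * φ.γs i) * (γs i - w.γs) ^ 2 := by
      rw [Finset.mul_sum]
      refine Finset.sum_le_sum fun i _ => ?_
      have h0 := hφγs i
      have h1 : 0 ≤ (γs i - w.γs) ^ 2 / (2 * φ.γs i) := by positivity
      calc _ ≤ σ.γs i * ((γs i - w.γs) ^ 2 / (2 * φ.γs i)) := by
            gcongr
            exact hργs.trans (hρ₃' i)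
        _ = _ := by ring
    have hobsv := hκ' e
    set Y := ‖e‖ with hY
    set X := ‖x‖ with hX
    set S := ∑ i, ‖(D.Tu i)ᵀ ⊡ net.lap e i‖ ^ 2 with hS
    set T := ∑ i, ‖(D.Td i)ᵀ ⊡ e i‖ ^ 2 with hT
    have hTnn : 0 ≤ T := hDnn e
    have hkS : (H φ.β + cE) * Y ^ 2 ≤ w.k / 2 * S + w.k / 2 * T := by
      have hSnn : 0 ≤ S := Finset.sum_nonneg fun i _ => by positivity
      calc _ ≤ (H φ.β + cE) * (κ * (S + T)) := by gcongr
        _ ≤ _ := by rw [hwk]; linarith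
    have hHs : H φ.β * Y ^ 2 = (c₂ + (c₁ + c₂) ^ 2 / (2 * q)) * Y ^ 2
        + ∑ ι, ((2 * b + c₂) ^ 2 + b ^ 2) * (φ.β ι / σ.β ι) * Y ^ 2 := by
      rw [hH, ← Finset.sum_mul, add_mul]
    have hE : ρ * net.energy e ≤ cE * Y ^ 2 := by
      have h1 := hcE' e
      have h2 := hg.energy_nonneg e
      nlinarith
    have hPx : ρ * inner ℝ x (c.P ⊡ x) ≤ q / 2 * X ^ 2 := by
      calc _ ≤ ρ * (pb * X ^ 2) := by gcongr; exact hpb' x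
        _ = ρ * pb * X ^ 2 := by ring
        _ ≤ _ := by gcongr
    have hDk : ρ * (w.k * ∑ i, inner ℝ ((D.Td i)ᵀ ⊡ e i) (w.Q i ⊡ (D.Td i)ᵀ ⊡ e i))
        ≤ w.k / 2 * T := by
      have hk0 : 0 ≤ w.k := zero_le_one.trans hk1
      calc _ ≤ ρ * (w.k * (qb * T)) := by gcongr; exact hDQb e
        _ = ρ * qb * (w.k * T) := by ring
        _ ≤ 1 / 2 * (w.k * T) := by gcongr
        _ = _ := by ring
    have hsβ : c₂ * ((X + Y + ∑ ι, β ι) * Y) = c₂ * ((X + Y) * Y) + ∑ ι, c₂ * β ι * Y := by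
      rw [← Finset.sum_mul, ← Finset.mul_sum]
      ring
    have hwS : ∑ i, -w.γ * ‖(D.Tu i)ᵀ ⊡ net.lap e i‖ ^ 2 = -(w.k / 2) * S := by
      rw [hS, Finset.mul_sum, hwγ]
    rw [hsβ] at ho
    simp only [Finset.sum_add_distrib, Finset.sum_sub_distrib] at hβsum hγsum hγssum hp ho
    rw [hwS] at hγsum
    unfold LyapunovWeights.stateValue LyapunovWeights.gainValue LyapunovWeights.residual
    simp only [Finset.sum_add_distrib]
    simp only [neg_mul, Finset.sum_neg_distrib] at *
    linarith

end

/-! ### Error dynamics and the Lyapunov function along solutions -/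

section

variable {net : ControlNetwork} {D : ObserverDesign net} {c : ControllerDesign net}
  {σ : Leakage net} {φ : Tuning net} {v : ℝ → Vec net.mv} {T : EReal} {s : Trajectory net}

/-- Along `T_id`, `G_i C_i B_{-i} = T_idᵀ B_{-i}` removes the unavailable input and the Sylvester
equation removes the state. Along `T_iu`, orthogonality to `T_id` removes the output injection, and
the hidden input survives. -/
theorem ObserverDesign.Admissible.error_velocity (hA : D.Admissible) (hnet : net.WellPosed)
    (i : Fin net.N) {x z e x' z' e' : Vec net.n} {u : ∀ ι, Vec (net.mc ι)} {v : Vec net.mv}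
    {γ γs : ℝ} {ε h : Vec (net.n - D.δ i)}
    (he : e = z + D.Gbar i ⊡ net.C i ⊡ x - x)
    (hx' : x' = net.A ⊡ x + (∑ ι, net.Bc ι ⊡ u ι) + net.Bv ⊡ v)
    (hz' : z' = D.Ebar i ⊡ z + D.Fbar i ⊡ net.C i ⊡ x + D.Bbar i ⊡ net.localInput u i
      - (γ • D.Tu i ⊡ ε + γs • D.Tu i ⊡ h))
    (he' : e' = z' + D.Gbar i ⊡ net.C i ⊡ x' - x') :
    (D.Td i)ᵀ ⊡ e' = D.E i ⊡ (D.Td i)ᵀ ⊡ e ∧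
    (D.Tu i)ᵀ ⊡ e' = (D.Tu i)ᵀ ⊡ (net.A ⊡ e - net.hiddenInput u v i) - γ • ε - γs • h := by
  have hdd : ∀ y : Vec (D.δ i), (D.Td i)ᵀ ⊡ D.Td i ⊡ y = y := fun y => by
    rw [← mul_toEuclideanLin, hA.orth, one_toEuclideanLin]
  have huu : ∀ y : Vec (net.n - D.δ i), (D.Tu i)ᵀ ⊡ D.Tu i ⊡ y = y := fun y => by
    rw [← mul_toEuclideanLin, hA.Tu_orth, one_toEuclideanLin]
  have hdu : ∀ y : Vec (net.n - D.δ i), (D.Td i)ᵀ ⊡ D.Tu i ⊡ y = 0 := fun y => by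
    rw [← mul_toEuclideanLin, hA.Td_Tu, map_zero, LinearMap.zero_apply]
  have hud : ∀ y : Vec (D.δ i), (D.Tu i)ᵀ ⊡ D.Td i ⊡ y = 0 := fun y => by
    have : (D.Tu i)ᵀ * D.Td i = 0 := by
      rw [← Matrix.transpose_transpose (D.Td i), ← Matrix.transpose_mul, hA.Td_Tu,
        Matrix.transpose_zero]
    rw [← mul_toEuclideanLin, this, map_zero, LinearMap.zero_apply]
  constructor
  · obtain ⟨w, hw⟩ := hnet.split_local i u v
    rw [add_assoc, hw] at hx'
    have hdec := congrArg (fun M => M ⊡ w) (hA.decouple i)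
    have hsyl := congrArg (fun M => M ⊡ x) (hA.sylvester i)
    simp only [mul_toEuclideanLin, add_toEuclideanLin, sub_toEuclideanLin,
      Matrix.sub_mul, map_zero, LinearMap.zero_apply] at hdec hsyl
    rw [he', hz', he, hx']
    simp only [ObserverDesign.Ebar, ObserverDesign.Fbar, ObserverDesign.Bbar, ObserverDesign.Gbar,
      mul_toEuclideanLin, one_toEuclideanLin, map_add, map_sub, LinearMap.add_apply,
      LinearMap.sub_apply, map_smul, hdd, hdu, hdec, smul_zero]
    rw [← sub_eq_zero]
    refine Eq.trans ?_ hsyl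
    abel
  · rw [he', hz', he, hx', ControlNetwork.hiddenInput]
    simp only [ObserverDesign.Ebar, ObserverDesign.Fbar, ObserverDesign.Bbar, ObserverDesign.Gbar,
      mul_toEuclideanLin, one_toEuclideanLin, map_add, map_sub, LinearMap.add_apply,
      LinearMap.sub_apply, map_smul, huu, hud]
    abel

theorem hasDerivAt_toEuclideanLin {k l : ℕ} (M : Matrix (Fin k) (Fin l) ℝ) {f : ℝ → Vec l}
    {f' : Vec l} {t : ℝ} (hf : HasDerivAt f f' t) : HasDerivAt (fun t => M ⊡ f t) (M ⊡ f') t :=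
  (LinearMap.toContinuousLinearMap (Matrix.toEuclideanLin M)).hasFDerivAt.comp_hasDerivAt t hf

theorem hasDerivAt_quadratic {k : ℕ} {M : Matrix (Fin k) (Fin k) ℝ} (hM : Mᵀ = M)
    {f : ℝ → Vec k} {f' : Vec k} {t : ℝ} (hf : HasDerivAt f f' t) :
    HasDerivAt (fun t => inner ℝ (f t) (M ⊡ f t)) (2 * inner ℝ (M ⊡ f t) f') t := by
  refine (hf.inner ℝ (hasDerivAt_toEuclideanLin M hf)).congr_deriv ?_
  rw [inner_toEuclideanLin_right, hM, real_inner_comm (M ⊡ f t) f']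
  ring

/-- The Laplacian is symmetric, so both terms of the product rule agree and absorb the factor `1 /
2`. -/
theorem ControlNetwork.ConnectedGraph.hasDerivAt_energy (hg : net.ConnectedGraph)
    {e : ℝ → Fin net.N → Vec net.n} {e' : Fin net.N → Vec net.n} {t : ℝ}
    (he : ∀ i, HasDerivAt (fun t => e t i) (e' i) t) :
    HasDerivAt (fun t => net.energy (e t)) (∑ i, inner ℝ (net.lap (e t) i) (e' i)) t := by
  have hl : ∀ i, HasDerivAt (fun t => net.lap (e t) i) (net.lap e' i) t := fun i => by
    unfold ControlNetwork.lap
    exact HasDerivAt.fun_sum fun j _ => ((he i).fun_sub (he j)).fun_const_smul _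
  unfold ControlNetwork.energy
  have h := (HasDerivAt.fun_sum (u := Finset.univ) fun i _ => (hl i).inner ℝ (he i)).const_mul
    (1 / 2 : ℝ)
  refine h.congr_deriv ?_
  have h1 := hg.two_mul_sum_inner_lap (e t) e'
  have h2 := hg.two_mul_sum_inner_lap e' (e t)
  have h3 : ∑ i, ∑ j, net.a i j * inner ℝ (e t i - e t j) (e' i - e' j)
      = ∑ i, ∑ j, net.a i j * inner ℝ (e' i - e' j) (e t i - e t j) :=
    Finset.sum_congr rfl fun i _ => Finset.sum_congr rfl fun j _ => by rw [real_inner_comm]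
  rw [Finset.sum_add_distrib]
  linarith

theorem LyapunovWeights.hasDerivAt_stateValue (w : LyapunovWeights D) (hg : net.ConnectedGraph)
    {P : Matrix (Fin net.n) (Fin net.n) ℝ} (hP : Pᵀ = P) (hQ : ∀ i, (w.Q i)ᵀ = w.Q i)
    {x : ℝ → Vec net.n} {e : ℝ → Fin net.N → Vec net.n} {x' : Vec net.n}
    {e' : Fin net.N → Vec net.n} {t : ℝ}
    (hx : HasDerivAt x x' t) (he : ∀ i, HasDerivAt (fun t => e t i) (e' i) t) :
    HasDerivAt (fun t => w.stateValue P (x t) (e t))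
      (2 * inner ℝ (P ⊡ x t) x' + ∑ i, inner ℝ (net.lap (e t) i) (e' i)
        + w.k * ∑ i, 2 * inner ℝ (w.Q i ⊡ (D.Td i)ᵀ ⊡ e t i) ((D.Td i)ᵀ ⊡ e' i)) t := by
  unfold LyapunovWeights.stateValue
  exact ((hasDerivAt_quadratic hP hx).add (hg.hasDerivAt_energy he)).add
    ((HasDerivAt.fun_sum fun i _ => hasDerivAt_quadratic (hQ i) (hasDerivAt_toEuclideanLin _ (he i))).const_mul _)

theorem hasDerivAt_sub_sq_div {f : ℝ → ℝ} {f' t a b d : ℝ} (hf : HasDerivAt f f' t) :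
    HasDerivAt (fun t => (f t - a) ^ 2 / (b * d)) (2 * (f t - a) * f' / (b * d)) t := by
  simpa using ((hf.sub_const a).pow 2).div_const (b * d)

theorem LyapunovWeights.hasDerivAt_gainValue (w : LyapunovWeights D) (φ : Tuning net)
    {β : Fin net.Nc → ℝ → ℝ} {γ γs : Fin net.N → ℝ → ℝ} {β' : Fin net.Nc → ℝ}
    {γ' γs' : Fin net.N → ℝ} {t : ℝ} (hβ : ∀ ι, HasDerivAt (β ι) (β' ι) t)
    (hγ : ∀ i, HasDerivAt (γ i) (γ' i) t) (hγs : ∀ i, HasDerivAt (γs i) (γs' i) t) :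
    HasDerivAt (fun t => w.gainValue φ (fun ι => β ι t) (fun i => γ i t) fun i => γs i t)
      (∑ ι, 2 * (β ι t - w.β) * β' ι / φ.β ι + ∑ i, (γ i t - w.γ) * γ' i / φ.γ i
        + ∑ i, (γs i t - w.γs) * γs' i / φ.γs i) t := by
  unfold LyapunovWeights.gainValue
  refine ((HasDerivAt.fun_sum fun ι _ => ?_).add (HasDerivAt.fun_sum fun i _ => ?_)).add
    (HasDerivAt.fun_sum fun i _ => ?_)
  · simpa using hasDerivAt_sub_sq_div (a := w.β) (b := 1) (d := φ.β ι) (hβ ι)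
  · refine (hasDerivAt_sub_sq_div (a := w.γ) (b := 2) (d := φ.γ i) (hγ i)).congr_deriv ?_
    rw [mul_assoc, mul_div_mul_left _ _ two_ne_zero]
  · refine (hasDerivAt_sub_sq_div (a := w.γs) (b := 2) (d := φ.γs i) (hγs i)).congr_deriv ?_
    rw [mul_assoc, mul_div_mul_left _ _ two_ne_zero]

theorem ControlNetwork.lap_sub_const (xh : Fin net.N → Vec net.n) (x : Vec net.n)
    (i : Fin net.N) : net.lap (fun i => xh i - x) i = ∑ j, net.a i j • (xh i - xh j) := by
  simp only [ControlNetwork.lap, sub_sub_sub_cancel_right]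

namespace Trajectory

theorem dis_eq (s : Trajectory net) (D : ObserverDesign net) (t : ℝ) (i : Fin net.N) :
    s.dis D t i = (D.Tu i)ᵀ ⊡ net.lap (s.err D t) i := by
  have : s.err D t = fun i => s.xhat D t i - s.x t := rfl
  rw [this, ControlNetwork.lap_sub_const]
  rfl

variable (hs : s.IsSolution D c σ φ v T)
include hs

/-- The adaptation input is nonnegative, so `β` stays above `exp (-σ t) β(0)`: compare `-β` with the
pure leakage equation. -/
theorem IsSolution.β_nonneg (hσ : σ.Pos) (hφ : φ.Pos) {t : ℝ} (ht : 0 ≤ t) (htT : (t : EReal) < T)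
    (ι : Fin net.Nc) : 0 ≤ s.β ι t := by
  have h := (hs.ac_β ι t ht htT).fun_neg.le_exp_of_ae_deriv_le (k := σ.β ι) (c := 0) ht (hσ.1 ι) (by
    filter_upwards [hs.deriv_β ι] with τ hτ h0 h1
    refine ⟨_, (hτ h0 ((EReal.coe_lt_coe_iff.2 h1).trans htT)).neg, ?_⟩
    have := mul_nonneg (hφ.2.1 ι).le (norm_nonneg (s.sliding D c τ ι))
    linarith)
  have h2 := mul_pos (Real.exp_pos (-σ.β ι * t)) (hs.β_pos ι)
  simp only [zero_div, sub_zero, add_zero, mul_neg] at h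
  linarith

theorem IsSolution.ac_err {t : ℝ} (ht : 0 ≤ t) (htT : (t : EReal) < T) (i : Fin net.N) :
    AbsolutelyContinuousOnInterval (fun t => s.err D t i) 0 t :=
  ((hs.ac_z i t ht htT).fun_add (((hs.ac_x t ht htT).linear_comp (Matrix.toEuclideanLin
    (net.C i))).linear_comp (Matrix.toEuclideanLin (D.Gbar i)))).fun_sub (hs.ac_x t ht htT)

theorem IsSolution.ae_hasDerivAt_err (hnet : net.WellPosed) (hA : D.Admissible) :
    ∀ᵐ t : ℝ, 0 < t → (t : EReal) < T → ∃ e' : Fin net.N → Vec net.n,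
      (∀ i, HasDerivAt (fun t => s.err D t i) (e' i) t) ∧
      (∀ i, (D.Td i)ᵀ ⊡ e' i = D.E i ⊡ (D.Td i)ᵀ ⊡ s.err D t i) ∧
      ∀ i, ∃ h ∈ unitSet ((D.Tu i)ᵀ ⊡ net.lap (s.err D t) i), (D.Tu i)ᵀ ⊡ e' i
        = (D.Tu i)ᵀ ⊡ (net.A ⊡ s.err D t i
            - net.hiddenInput (c.feedback φ.ε (fun ι => s.β ι t) (s.xhat D t)) (v t) i)
          - s.γ i t • (D.Tu i)ᵀ ⊡ net.lap (s.err D t) i - s.γs i t • h := by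
  filter_upwards [hs.deriv_x, ae_all_iff.2 hs.deriv_z] with t hx hz h0 h1
  have hx := hx h0 h1
  choose h hh hz using fun i => hz i h0 h1
  refine ⟨_, fun i => ((hz i).add (hasDerivAt_toEuclideanLin (D.Gbar i)
    (hasDerivAt_toEuclideanLin (net.C i) hx))).sub hx, fun i => ?_, fun i => ⟨h i, ?_, ?_⟩⟩
  · exact (hA.error_velocity hnet i rfl rfl rfl rfl).1
  · rw [← dis_eq]
    exact hh i
  · rw [← dis_eq]
    exact (hA.error_velocity hnet i rfl rfl rfl rfl).2

theorem IsSolution.err_zero (i : Fin net.N) :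
    s.err D 0 i = D.Gbar i ⊡ net.C i ⊡ s.x 0 - s.x 0 := by
  simp only [Trajectory.err, Trajectory.xhat, ObserverDesign.estimate, hs.z_zero, zero_add]

/-- The component is constant since `E_i = 0`, and `z_i(0) = 0` with `G_i C_i = T_idᵀ` makes it
start at zero. -/
theorem IsSolution.static_err_eq_zero (hnet : net.WellPosed) (hA : D.Admissible) {t : ℝ}
    (ht : 0 ≤ t) (htT : (t : EReal) < T) (i : Fin net.N) (hE : D.E i = 0)
    (hG : D.G i * net.C i = (D.Td i)ᵀ) : (D.Td i)ᵀ ⊡ s.err D t i = 0 := by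
  have hac := ((hs.ac_err ht htT i).linear_comp (Matrix.toEuclideanLin (D.Td i)ᵀ)).norm_sq
  have hle := hac.le_of_ae_deriv_nonpos ht (by
    filter_upwards [hs.ae_hasDerivAt_err hnet hA] with τ hτ h0 h1
    obtain ⟨e', he', hd, -⟩ := hτ h0 ((EReal.coe_lt_coe_iff.2 h1).trans htT)
    refine ⟨_, (hasDerivAt_toEuclideanLin _ (he' i)).norm_sq, ?_⟩
    simp [hd i, hE])
  have h0 : (D.Td i)ᵀ ⊡ s.err D 0 i = 0 := by
    rw [hs.err_zero i, map_sub, ObserverDesign.Gbar, mul_toEuclideanLin, ← mul_toEuclideanLin,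
      hA.orth, one_toEuclideanLin, ← mul_toEuclideanLin, hG, sub_self]
  simp only [h0, norm_zero] at hle
  simpa using hle

/-- The Lyapunov function along the trajectory. -/
theorem IsSolution.ac_lyapunov (w : LyapunovWeights D) (P : Matrix (Fin net.n) (Fin net.n) ℝ)
    {t : ℝ} (ht : 0 ≤ t) (htT : (t : EReal) < T) :
    AbsolutelyContinuousOnInterval (fun t => w.stateValue P (s.x t) (s.err D t)
      + w.gainValue φ (fun ι => s.β ι t) (fun i => s.γ i t) fun i => s.γs i t) 0 t := by
  have hx := hs.ac_x t ht htT
  have he := fun i => hs.ac_err ht htT i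
  have hsq : ∀ {f : ℝ → ℝ} (_ : AbsolutelyContinuousOnInterval f 0 t) (a b : ℝ),
      AbsolutelyContinuousOnInterval (fun t => (f t - a) ^ 2 / b) 0 t := fun {f} hf a b => by
    have h := (hf.fun_sub (AbsolutelyContinuousOnInterval.const a 0 t)).norm_sq.const_mul b⁻¹
    simpa only [Real.norm_eq_abs, sq_abs, inv_mul_eq_div] using h
  have hlap : ∀ i, AbsolutelyContinuousOnInterval (fun t => net.lap (s.err D t) i) 0 t :=
    fun i => AbsolutelyContinuousOnInterval.finset_sum _ fun j _ =>
      ((he i).fun_sub (he j)).const_smul (net.a i j)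
  refine AbsolutelyContinuousOnInterval.fun_add (.fun_add (.fun_add ?_ ?_) ?_)
    (.fun_add (.fun_add ?_ ?_) ?_)
  · exact hx.inner (hx.linear_comp (Matrix.toEuclideanLin P))
  · exact (AbsolutelyContinuousOnInterval.finset_sum _ fun i _ =>
      (hlap i).inner (he i)).const_mul _
  · refine (AbsolutelyContinuousOnInterval.finset_sum _ fun i _ => ?_).const_mul _
    have hd := (he i).linear_comp (Matrix.toEuclideanLin (D.Td i)ᵀ)
    exact hd.inner (hd.linear_comp (Matrix.toEuclideanLin (w.Q i)))
  · exact AbsolutelyContinuousOnInterval.finset_sum _ fun ι _ => hsq (hs.ac_β ι t ht htT) _ _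
  · exact AbsolutelyContinuousOnInterval.finset_sum _ fun i _ => hsq (hs.ac_γ i t ht htT) _ _
  · exact AbsolutelyContinuousOnInterval.finset_sum _ fun i _ => hsq (hs.ac_γs i t ht htT) _ _

end Trajectory

/-- Outside the ball, compare with the radial projection. -/
theorem infDist_closedBall_le {E : Type*} [NormedAddCommGroup E] [NormedSpace ℝ E] {p : E}
    {r b : ℝ} (hr : 0 ≤ r) (hb : 0 ≤ b) (h : ‖p‖ ≤ r + b) :
    Metric.infDist p (Metric.closedBall 0 r) ≤ b := by
  by_cases hp : ‖p‖ ≤ r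
  · rw [Metric.infDist_zero_of_mem (by simpa using hp)]
    exact hb
  · have hp' : r < ‖p‖ := not_le.1 hp
    have hp0 : 0 < ‖p‖ := hr.trans_lt hp'
    refine (Metric.infDist_le_dist_of_mem (y := (r / ‖p‖) • p) ?_).trans ?_
    · rw [mem_closedBall_zero_iff, norm_smul, Real.norm_of_nonneg (by positivity),
        div_mul_cancel₀ _ hp0.ne']
    · have h1 : p - (r / ‖p‖) • p = (1 - r / ‖p‖) • p := by rw [sub_smul, one_smul]
      rw [dist_eq_norm, h1, norm_smul, Real.norm_of_nonneg (by
        rw [sub_nonneg, div_le_one hp0]; exact hp'.le), sub_mul, div_mul_cancel₀ _ hp0.ne']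
      linarith

end

/-! ### Initial values, gain bounds and the size of the residual -/

section

variable {net : ControlNetwork} {D : ObserverDesign net}

/-- Because `z_i(0) = 0`, the initial errors are linear in `x(0)`; a bound on `x(0)` therefore
bounds the initial state part of `V`. -/
theorem LyapunovWeights.exists_stateValue_le (w : LyapunovWeights D)
    (P : Matrix (Fin net.n) (Fin net.n) ℝ) :
    ∃ b, 0 < b ∧ ∀ x : Vec net.n,
      w.stateValue P x (fun i => D.Gbar i ⊡ net.C i ⊡ x - x) ≤ b * ‖x‖ ^ 2 := by
  refine exists_upper_bound_of_homogeneous ?_ fun r x => ?_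
  · have h1 := continuous_toEuclideanLin P
    have h2 := fun i => continuous_toEuclideanLin (D.Gbar i)
    have h3 := fun i => continuous_toEuclideanLin (net.C i)
    have h4 := fun i => continuous_toEuclideanLin (D.Td i)ᵀ
    have h5 := fun i => continuous_toEuclideanLin (w.Q i)
    have h6 : ∀ i, Continuous fun x : Vec net.n => D.Gbar i ⊡ net.C i ⊡ x - x := fun i =>
      ((h2 i).comp (h3 i)).sub continuous_id
    have h7 := fun i => (h4 i).comp (h6 i)
    exact ((continuous_id.inner h1).add (net.continuous_energy.comp (continuous_pi h6))).add
      (continuous_const.mul (continuous_finsetSum _ fun i _ =>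
        (h7 i).inner ((h5 i).comp (h7 i))))
  · have h1 : (fun i => D.Gbar i ⊡ net.C i ⊡ (r • x) - r • x)
        = r • fun i => D.Gbar i ⊡ net.C i ⊡ x - x := by
      funext i
      simp only [map_smul, Pi.smul_apply, smul_sub]
    rw [h1]
    simp only [LyapunovWeights.stateValue, ControlNetwork.energy_smul, Pi.smul_apply, map_smul,
      inner_smul_left, inner_smul_right, conj_trivial, ← Finset.mul_sum]
    ring

theorem LyapunovWeights.exists_gainValue_le (w : LyapunovWeights D) {φ : Tuning net}
    (hφ : φ.Pos) (r : ℝ) :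
    ∃ b, ∀ (β : Fin net.Nc → ℝ) (γ γs : Fin net.N → ℝ), (∀ ι, |β ι| ≤ r) → (∀ i, |γ i| ≤ r) →
      (∀ i, |γs i| ≤ r) → w.gainValue φ β γ γs ≤ b := by
  obtain ⟨-, h1, h2, h3⟩ := hφ
  have hsq : ∀ a b : ℝ, |a| ≤ r → (a - b) ^ 2 ≤ (r + |b|) ^ 2 := fun a b h =>
    sq_le_sq' (by linarith [neg_abs_le a, le_abs_self b]) (by linarith [le_abs_self a, neg_abs_le b])
  refine ⟨∑ ι, (r + |w.β|) ^ 2 / φ.β ι + ∑ i, (r + |w.γ|) ^ 2 / (2 * φ.γ i)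
    + ∑ i, (r + |w.γs|) ^ 2 / (2 * φ.γs i), fun β γ γs hβ hγ hγs => ?_⟩
  unfold LyapunovWeights.gainValue
  refine add_le_add (add_le_add ?_ ?_) ?_ <;> refine Finset.sum_le_sum fun i _ => ?_
  · exact div_le_div_of_nonneg_right (hsq _ _ (hβ i)) (h1 i).le
  · exact div_le_div_of_nonneg_right (hsq _ _ (hγ i)) (by linarith [h2 i])
  · exact div_le_div_of_nonneg_right (hsq _ _ (hγs i)) (by linarith [h3 i])

theorem abs_le_of_sq_div_le {y a d b : ℝ} (hd : 0 < d) (h : (y - a) ^ 2 / d ≤ b) :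
    |y| ≤ |a| + 1 + d * b := by
  rw [div_le_iff₀ hd] at h
  have h1 : |y - a| ≤ 1 + (y - a) ^ 2 := by
    rw [← sq_abs]
    nlinarith [sq_nonneg (|y - a| - 1), abs_nonneg (y - a)]
  have h2 := abs_sub_abs_le_abs_sub y a
  linarith

theorem LyapunovWeights.gainValue_nonneg (w : LyapunovWeights D) {φ : Tuning net} (hφ : φ.Pos)
    (β : Fin net.Nc → ℝ) (γ γs : Fin net.N → ℝ) : 0 ≤ w.gainValue φ β γ γs := by
  obtain ⟨-, h1, h2, h3⟩ := hφ
  refine add_nonneg (add_nonneg ?_ ?_) ?_ <;> refine Finset.sum_nonneg fun i _ => ?_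
  · exact div_nonneg (sq_nonneg _) (h1 i).le
  · exact div_nonneg (sq_nonneg _) (by linarith [h2 i])
  · exact div_nonneg (sq_nonneg _) (by linarith [h3 i])

theorem LyapunovWeights.exists_gain_bound (w : LyapunovWeights D) {φ : Tuning net} (hφ : φ.Pos)
    (b : ℝ) :
    ∃ M, ∀ (β : Fin net.Nc → ℝ) (γ γs : Fin net.N → ℝ), w.gainValue φ β γ γs ≤ b →
      (∀ ι, |β ι| ≤ M) ∧ (∀ i, |γ i| ≤ M) ∧ ∀ i, |γs i| ≤ M := by
  obtain ⟨-, h1, h2, h3⟩ := hφ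
  obtain ⟨M₁, -, hM₁⟩ := exists_uniform_bound
    (p := fun ι M => ∀ y : ℝ, (y - w.β) ^ 2 / φ.β ι ≤ b → |y| ≤ M)
    (fun i a b hab h y hy => (h y hy).trans hab) fun ι => ⟨_, fun y => abs_le_of_sq_div_le (h1 ι)⟩
  obtain ⟨M₂, -, hM₂⟩ := exists_uniform_bound
    (p := fun i M => ∀ y : ℝ, (y - w.γ) ^ 2 / (2 * φ.γ i) ≤ b → |y| ≤ M)
    (fun i a b hab h y hy => (h y hy).trans hab) fun i => ⟨_, fun y =>
      abs_le_of_sq_div_le (by linarith [h2 i])⟩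
  obtain ⟨M₃, -, hM₃⟩ := exists_uniform_bound
    (p := fun i M => ∀ y : ℝ, (y - w.γs) ^ 2 / (2 * φ.γs i) ≤ b → |y| ≤ M)
    (fun i a b hab h y hy => (h y hy).trans hab) fun i => ⟨_, fun y =>
      abs_le_of_sq_div_le (by linarith [h3 i])⟩
  refine ⟨max M₁ (max M₂ M₃), fun β γ γs h => ?_⟩
  unfold LyapunovWeights.gainValue at h
  have p1 : ∀ ι ∈ Finset.univ, 0 ≤ (β ι - w.β) ^ 2 / φ.β ι := fun ι _ =>
    div_nonneg (sq_nonneg _) (h1 ι).le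
  have p2 : ∀ i ∈ Finset.univ, 0 ≤ (γ i - w.γ) ^ 2 / (2 * φ.γ i) := fun i _ =>
    div_nonneg (sq_nonneg _) (by linarith [h2 i])
  have p3 : ∀ i ∈ Finset.univ, 0 ≤ (γs i - w.γs) ^ 2 / (2 * φ.γs i) := fun i _ =>
    div_nonneg (sq_nonneg _) (by linarith [h3 i])
  have q1 := Finset.sum_nonneg p1
  have q2 := Finset.sum_nonneg p2
  have q3 := Finset.sum_nonneg p3
  refine ⟨fun ι => ?_, fun i => ?_, fun i => ?_⟩
  · have := Finset.single_le_sum p1 (Finset.mem_univ ι)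
    exact (hM₁ ι _ (by linarith)).trans (le_max_left _ _)
  · have := Finset.single_le_sum p2 (Finset.mem_univ i)
    exact (hM₂ i _ (by linarith)).trans ((le_max_left _ _).trans (le_max_right _ _))
  · have := Finset.single_le_sum p3 (Finset.mem_univ i)
    exact (hM₃ i _ (by linarith)).trans ((le_max_right _ _).trans (le_max_right _ _))

theorem LyapunovWeights.residual_nonneg (w : LyapunovWeights D) {σ : Leakage net}
    {φ : Tuning net} (hσ : σ.Pos) (hφ : φ.Pos) : 0 ≤ w.residual σ φ := by
  obtain ⟨hε, h1, h2, h3⟩ := hφ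
  obtain ⟨s1, s2, s3⟩ := hσ
  refine add_nonneg (add_nonneg ?_ ?_) ?_ <;> refine Finset.sum_nonneg fun i _ => ?_
  · have := h1 i
    have := s1 i
    positivity
  · have := h2 i
    have := s2 i
    positivity
  · have := h3 i
    have := s3 i
    positivity

/-- The references for `β^ι` and `γ_is` are fixed, so one `Φ` handles their terms. The reference for
`γ_i` depends on `φ^ι`, so its threshold `Φ'` comes afterwards. -/
theorem exists_residual_le {σ : Leakage net} (hσ : σ.Pos)
    (w : (Fin net.Nc → ℝ) → LyapunovWeights D) {b₀ s₀ : ℝ}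
    (hβ : ∀ φ, (w φ).β = b₀) (hγs : ∀ φ, (w φ).γs = s₀) {L : ℝ} (hL : 0 < L) :
    ∃ ε₀ : ℝ, 0 < ε₀ ∧ ∃ Φ : ℝ, 0 < Φ ∧ ∀ φβ : Fin net.Nc → ℝ, (∀ ι, Φ ≤ φβ ι) →
      ∃ Φ' : ℝ, 0 < Φ' ∧ ∀ φγ φγs : Fin net.N → ℝ, (∀ i, Φ' ≤ φγ i) → (∀ i, Φ ≤ φγs i) →
        ∀ ε : ℝ, 0 < ε → ε ≤ ε₀ → (w φβ).residual σ ⟨ε, φβ, φγ, φγs⟩ ≤ L := by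
  obtain ⟨s1, s2, s3⟩ := hσ
  have hL4 : 0 < L / 4 := by positivity
  have hsum : ∀ {k : ℕ} {a φ : Fin k → ℝ} {b Φ : ℝ}, 0 < Φ → (∀ i, 0 < a i) → (∀ i, Φ ≤ φ i) →
      (∑ i, a i * b ^ 2) / (L / 4) ≤ Φ → ∑ i, a i / φ i * b ^ 2 ≤ L / 4 := by
    intro k a φ b Φ hΦ ha hφ h
    have h1 : ∑ i, a i / φ i * b ^ 2 ≤ ∑ i, a i * b ^ 2 / Φ := by
      refine Finset.sum_le_sum fun i _ => ?_
      rw [div_mul_eq_mul_div]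
      exact div_le_div_of_nonneg_left (mul_nonneg (ha i).le (sq_nonneg _)) hΦ (hφ i)
    rw [← Finset.sum_div] at h1
    refine h1.trans ?_
    rw [div_le_iff₀ hΦ]
    rw [div_le_iff₀ hL4] at h
    linarith
  have hnn : ∀ {k : ℕ} {a : Fin k → ℝ} {b : ℝ}, (∀ i, 0 < a i) →
      0 ≤ (∑ i, a i * b ^ 2) / (L / 4) := fun ha => div_nonneg
    (Finset.sum_nonneg fun i _ => mul_nonneg (ha i).le (sq_nonneg _)) hL4.le
  have s1' : ∀ ι, 0 < 2 * σ.β ι := fun ι => by linarith [s1 ι]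
  have n1 := hnn (b := b₀) s1'
  have n3 := hnn (b := s₀) s3
  -- Each of the four sums gets a quarter of `L`.
  refine ⟨L / 4 / (2 * net.Nc + 1), by positivity,
    (∑ ι, 2 * σ.β ι * b₀ ^ 2) / (L / 4) + (∑ i, σ.γs i * s₀ ^ 2) / (L / 4) + 1, by positivity,
    fun φβ hφβ => ⟨(∑ i, σ.γ i * (w φβ).γ ^ 2) / (L / 4) + 1, ?_,
      fun φγ φγs hφγ hφγs ε hε hεle => ?_⟩⟩
  · have := hnn (b := (w φβ).γ) s2
    positivity
  · have n2 := hnn (b := (w φβ).γ) s2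
    have t1 := hsum (by positivity) s1' hφβ (by linarith : (∑ ι, 2 * σ.β ι * b₀ ^ 2) / (L / 4) ≤ _)
    have t2 := hsum (by positivity) s2 hφγ
      (by linarith : (∑ i, σ.γ i * (w φβ).γ ^ 2) / (L / 4) ≤ _)
    have t3 := hsum (by positivity) s3 hφγs (by linarith : (∑ i, σ.γs i * s₀ ^ 2) / (L / 4) ≤ _)
    have t0 : ∑ _ι : Fin net.Nc, 2 * ε ≤ L / 4 := by
      rw [le_div_iff₀ (by positivity)] at hεle
      rw [Finset.sum_const, Finset.card_univ, Fintype.card_fin, nsmul_eq_mul]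
      linarith
    have hφγpos : ∀ i, 0 < φγ i := fun i => lt_of_lt_of_le (by positivity) (hφγ i)
    have hφγspos : ∀ i, 0 < φγs i := fun i => lt_of_lt_of_le (by positivity) (hφγs i)
    have e1 : ∀ ι, 2 * σ.β ι / φβ ι * b₀ ^ 2 = 2 * (σ.β ι / φβ ι) * b₀ ^ 2 := fun ι => by ring
    have e2 : ∑ i, σ.γ i / (2 * φγ i) * (w φβ).γ ^ 2 ≤ ∑ i, σ.γ i / φγ i * (w φβ).γ ^ 2 :=
      Finset.sum_le_sum fun i _ => mul_le_mul_of_nonneg_right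
        (div_le_div_of_nonneg_left (s2 i).le (hφγpos i) (by linarith [hφγpos i])) (sq_nonneg _)
    have e3 : ∑ i, σ.γs i / (2 * φγs i) * s₀ ^ 2 ≤ ∑ i, σ.γs i / φγs i * s₀ ^ 2 :=
      Finset.sum_le_sum fun i _ => mul_le_mul_of_nonneg_right
        (div_le_div_of_nonneg_left (s3 i).le (hφγspos i) (by linarith [hφγspos i])) (sq_nonneg _)
    simp only [e1] at t1
    unfold LyapunovWeights.residual
    rw [hβ, hγs, Finset.sum_add_distrib]
    dsimp only
    linarith

end

/-! ### Convergence to the residual ball -/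

theorem theorem6 (net : ControlNetwork) (D : ObserverDesign net) (c : ControllerDesign net)
    (σ : Leakage net)
    (hnet : net.WellPosed) (hD : D.Admissible)
    (hstab : IsStabilizable net.A net.B) (hmatch : net.Matched)
    (hgraph : net.ConnectedGraph) (hdet : D.CollectivelyDetectable)
    (hc : c.Lyapunov) (hσ : σ.Pos) :
    ∃ α : ℝ, 0 < α ∧ ∀ vbar : ℝ, 0 ≤ vbar →
      ∃ R : Tuning net → Set (Vec net.n × (Fin net.N → Vec net.n)),
        (∀ φ : Tuning net, φ.Pos →
          0 ∈ R φ ∧ Bornology.IsBounded (R φ) ∧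
          ∀ r : ℝ, ∃ M : ℝ, ∀ (v : ℝ → Vec net.mv) (T : EReal) (s : Trajectory net),
            (∀ t : ℝ, 0 ≤ t → (t : EReal) < T → ‖v t‖ ≤ vbar) →
            s.IsSolution D c σ φ v T →
            ‖s.x 0‖ ≤ r → (∀ ι, s.β ι 0 ≤ r) → (∀ i, s.γ i 0 ≤ r) → (∀ i, s.γs i 0 ≤ r) →
            ∀ t : ℝ, 0 ≤ t → (t : EReal) < T →
              (∀ ι, |s.β ι t| ≤ M) ∧ (∀ i, |s.γ i t| ≤ M) ∧ (∀ i, |s.γs i t| ≤ M) ∧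
              Metric.infDist (s.x t, s.err D t) (R φ) ≤ M * Real.exp (-α * t)) ∧
        (∀ η : ℝ, 0 < η →
          ∃ ε₀ : ℝ, 0 < ε₀ ∧ ∃ Φ : ℝ, 0 < Φ ∧
            ∀ φβ : Fin net.Nc → ℝ, (∀ ι, Φ ≤ φβ ι) →
              ∃ Φ' : ℝ, 0 < Φ' ∧
                ∀ φγ φγs : Fin net.N → ℝ, (∀ i, Φ' ≤ φγ i) → (∀ i, Φ ≤ φγs i) →
                  ∀ ε : ℝ, 0 < ε → ε ≤ ε₀ →
                    R ⟨ε, φβ, φγ, φγs⟩ ⊆ Metric.closedBall 0 η) := by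
  obtain ⟨Q, ρ, a, b₀, s₀, k, hρ, ha, hQ, hdiss⟩ :=
    exists_dissipation (σ := σ) hnet hD hmatch hgraph hdet hc hσ
  -- `V` decays at rate `ρ` and is quadratic in the state, so distances decay at half that rate.
  refine ⟨ρ / 2, by positivity, fun vbar _ => ?_⟩
  set w : (Fin net.Nc → ℝ) → LyapunovWeights D := fun φβ =>
    ⟨Q, k φβ, b₀ * vbar, k φβ / 2, s₀ * vbar⟩ with hw
  refine ⟨fun φ => Metric.closedBall 0 √((w φ.β).residual σ φ / (ρ * a)), fun φ hφ =>
    ⟨by simp, Metric.isBounded_closedBall, fun r => ?_⟩, fun η hη => ?_⟩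
  · obtain ⟨hcoer, hdec⟩ := hdiss φ hφ vbar (w φ.β) rfl
    set res := (w φ.β).residual σ φ with hres
    have hres0 : 0 ≤ res := (w φ.β).residual_nonneg hσ hφ
    obtain ⟨b, hb, hb'⟩ := (w φ.β).exists_stateValue_le c.P
    obtain ⟨g, hg⟩ := (w φ.β).exists_gainValue_le hφ r
    set M₀ := b * r ^ 2 + |g| with hM₀
    have hM₀nn : 0 ≤ M₀ := by positivity
    -- `M₀` bounds the initial value of `V`, so `V ≤ M₀ + res / ρ` throughout.
    obtain ⟨M, hM⟩ := (w φ.β).exists_gain_bound hφ (M₀ + res / ρ)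
    refine ⟨max M √(M₀ / a), fun v T s hv hs hx hβ hγ hγs t ht htT => ?_⟩
    have hcomp := (hs.ac_lyapunov (w φ.β) c.P ht htT).le_exp_of_ae_deriv_le (k := ρ) (c := res)
      ht hρ (by
      filter_upwards [hs.deriv_x, hs.ae_hasDerivAt_err hnet hD, ae_all_iff.2 hs.deriv_β,
        ae_all_iff.2 hs.deriv_γ, ae_all_iff.2 hs.deriv_γs] with τ h1 h2 h3 h4 h5 h0 hτ
      have hτT : (τ : EReal) < T := (EReal.coe_lt_coe_iff.2 hτ).trans htT
      obtain ⟨e', he', hd, hu⟩ := h2 h0 hτT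
      refine ⟨_, ((w φ.β).hasDerivAt_stateValue hgraph ?_ hQ (h1 h0 hτT) he').add
        ((w φ.β).hasDerivAt_gainValue φ (fun ι => h3 ι h0 hτT) (fun i => h4 i h0 hτT)
          fun i => h5 i h0 hτT), ?_⟩
      · rw [← Matrix.conjTranspose_eq_transpose_of_trivial]
        exact hc.1.isHermitian
      · have := hdec (fun ι => s.β ι τ) (fun i => s.γ i τ) (fun i => s.γs i τ) (s.x τ)
          (s.xhat D τ) (v τ) (s.err D τ) e' (fun ι => hs.β_nonneg hσ hφ h0.le hτT ι)
          (hv τ h0.le hτT) rfl hd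
          (fun i hE _ hG => hs.static_err_eq_zero hnet hD h0.le hτT i hE hG) hu
        simp only [← Trajectory.dis_eq] at this
        exact this)
    have hr0 : 0 ≤ r := (norm_nonneg _).trans hx
    have hinit : (w φ.β).stateValue c.P (s.x 0) (s.err D 0)
        + (w φ.β).gainValue φ (fun ι => s.β ι 0) (fun i => s.γ i 0) (fun i => s.γs i 0) ≤ M₀ := by
      have he0 : s.err D 0 = fun i => D.Gbar i ⊡ net.C i ⊡ s.x 0 - s.x 0 :=
        funext fun i => hs.err_zero i
      have h1 := hb' (s.x 0)
      rw [← he0] at h1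
      have h2 : b * ‖s.x 0‖ ^ 2 ≤ b * r ^ 2 := by gcongr
      have h3 := hg (fun ι => s.β ι 0) (fun i => s.γ i 0) (fun i => s.γs i 0)
        (fun ι => by rw [abs_of_pos (hs.β_pos ι)]; exact hβ ι)
        (fun i => by rw [abs_of_pos (hs.γ_pos i)]; exact hγ i)
        (fun i => by rw [abs_of_pos (hs.γs_pos i)]; exact hγs i)
      have h4 := le_abs_self g
      linarith
    have hV : (w φ.β).stateValue c.P (s.x t) (s.err D t)
        + (w φ.β).gainValue φ (fun ι => s.β ι t) (fun i => s.γ i t) (fun i => s.γs i t)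
        ≤ Real.exp (-ρ * t) * M₀ + res / ρ := by
      have h1 : 0 ≤ res / ρ := by positivity
      refine hcomp.trans ?_
      gcongr
      linarith
    have hexp1 : Real.exp (-ρ * t) ≤ 1 := Real.exp_le_one_iff.2 (by nlinarith)
    have hstate := hcoer (s.x t) (s.err D t)
    have hgain := (w φ.β).gainValue_nonneg hφ (fun ι => s.β ι t) (fun i => s.γ i t)
      (fun i => s.γs i t)
    obtain ⟨g1, g2, g3⟩ := hM (fun ι => s.β ι t) (fun i => s.γ i t) (fun i => s.γs i t) (by
      have h1 : 0 ≤ a * (‖s.x t‖ ^ 2 + ‖s.err D t‖ ^ 2) := by positivity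
      have h2 : Real.exp (-ρ * t) * M₀ ≤ M₀ := mul_le_of_le_one_left hM₀nn hexp1
      linarith)
    refine ⟨fun ι => (g1 ι).trans (le_max_left _ _), fun i => (g2 i).trans (le_max_left _ _),
      fun i => (g3 i).trans (le_max_left _ _), ?_⟩
    have hexp : Real.exp (-(ρ / 2) * t) ^ 2 = Real.exp (-ρ * t) := by
      rw [← Real.exp_nat_mul]
      congr 1
      push_cast
      ring
    have hpn : ‖(s.x t, s.err D t)‖ ^ 2 ≤ ‖s.x t‖ ^ 2 + ‖s.err D t‖ ^ 2 := by
      rw [Prod.norm_def]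
      rcases max_choice ‖s.x t‖ ‖s.err D t‖ with h | h
      · simp only [h]
        linarith [sq_nonneg ‖s.err D t‖]
      · simp only [h]
        linarith [sq_nonneg ‖s.x t‖]
    refine infDist_closedBall_le (Real.sqrt_nonneg _) (by positivity) ?_
    have hB : √(M₀ / a) * Real.exp (-(ρ / 2) * t)
        ≤ max M √(M₀ / a) * Real.exp (-(ρ / 2) * t) := by
      gcongr
      exact le_max_right _ _
    refine le_trans ?_ (add_le_add_right hB _)
    -- Compare squares: the two radii square to the two parts of the bound on `V / a`, and the cross
    -- term is nonnegative.
    refine abs_le_of_sq_le_sq' ?_ (by positivity) |>.2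
    have h1 : √(res / (ρ * a)) ^ 2 = res / (ρ * a) := Real.sq_sqrt (by positivity)
    have h2 : √(M₀ / a) ^ 2 = M₀ / a := Real.sq_sqrt (by positivity)
    have h3 : ‖(s.x t, s.err D t)‖ ^ 2 ≤ (Real.exp (-ρ * t) * M₀ + res / ρ) / a := by
      rw [le_div_iff₀ ha]
      have := mul_le_mul_of_nonneg_left hpn ha.le
      linarith
    have h4 : (Real.exp (-ρ * t) * M₀ + res / ρ) / a
        = res / (ρ * a) + M₀ / a * Real.exp (-ρ * t) := by field_simp; ring
    have h5 : 0 ≤ √(res / (ρ * a)) * (√(M₀ / a) * Real.exp (-(ρ / 2) * t)) := by positivity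
    rw [add_sq, mul_pow, h1, h2, hexp]
    linarith
  -- A residual of at most `η² ρ a` makes the radius at most `η`.
  · obtain ⟨ε₀, hε₀, Φ, hΦ, h⟩ := exists_residual_le (D := D) hσ w (b₀ := b₀ * vbar)
      (s₀ := s₀ * vbar) (fun _ => rfl) (fun _ => rfl) (by positivity : 0 < η ^ 2 * (ρ * a))
    refine ⟨ε₀, hε₀, Φ, hΦ, fun φβ hφβ => ?_⟩
    obtain ⟨Φ', hΦ', h'⟩ := h φβ hφβ
    refine ⟨Φ', hΦ', fun φγ φγs hφγ hφγs ε hε hεle => Metric.closedBall_subset_closedBall ?_⟩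
    rw [Real.sqrt_le_left hη.le, div_le_iff₀ (by positivity)]
    exact h' φγ φγs hφγ hφγs ε hε hεle

end
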